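/- Let $n\ge 4$ and $m>0$, put $R_0=(m/2)^{1/(n-2)}$, and let $M=\{x\in\mathbb{R}^n : |x|\ge R_0\}$ carry the Riemannian Schwarzschild metric $$g_{Sch}=\Big(1+\frac{m}{2|x|^{n-2}}\Big)^{\frac{4}{n-2}}\delta ,$$ where $\delta$ is the Euclidean metric. Let $\Sigma=\rho(\Sigma_0)$, where $\Sigma_0=\{x\in\mathbb{R}^n : x_n=0,\ |x|\ge R_0\}$ and $\rho$ is any linear isometry of $\mathbb{R}^n$. Let $\xi$ be a unit normal field of $\Sigma$, $\nu$ the outward unit conormal of $\partial\Sigma=\Sigma\cap\{|x|=R_0\}$ in $\Sigma$, $\mathrm{Ric}$ the Ricci curvature of $g_{Sch}$, and $A_\Sigma$, $A_{\partial M}$ the second fundamental forms of $\Sigma$ and of the horizon $\partial M=\{|x|=R_0\}$ (the latter with respect to the unit normal $\eta$ pointing into $M$, $A_{\partial M}(V,W)=-g_{Sch}(\nabla_V\eta,W)$); all geometric quantities, including the Laplacian $\Delta_\Sigma$ and the measures $dv$ on $\Sigma$ and $ds$ on $\partial\Sigma$, refer to $g_{Sch}$ and to the metric it induces. For $R>R_0$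 let $\Sigma(R)=\Sigma\cap\{|x|\le R\}$, and for smooth $u:\Sigma(R)\to\mathbb{R}$ (up to the boundary) vanishing on $\{|x|=R\}$ put $$Q(u,u)=-\int_{\Sigma(R)}u\big(\Delta_\Sigma u+(\mathrm{Ric}(\xi,\xi)+|A_\Sigma|^2)u\big)\,dv+\int_{\partial\Sigma}u\Big(\frac{\partial u}{\partial\nu}-A_{\partial M}(\xi,\xi)u\Big)\,ds .$$ Let $\mathrm{Ind}_F(\Sigma(R))$ be the maximal dimension of a linear space $V$ of such functions with $Q(u,u)<0$ for all $u\in V\setminus\{0\}$, and define the Morse index of $\Sigma$ by $\mathrm{Ind}(\Sigma)=\limsup_{R\to\infty}\mathrm{Ind}_F(\Sigma(R))\in\{0,1,2,\dots,\infty\}$. Then $\mathrm{Ind}(\Sigma)=0$; that is, $\Sigma$ is stable. In particular $\mathrm{Ind}(\Sigma_0)=0$. -/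

import Mathlib

open MeasureTheory Filter
open scoped ContDiff

noncomputable section

namespace Schwarzschild

/-- Euclidean space `ℝⁿ`. -/
abbrev E (n : ℕ) : Type := EuclideanSpace ℝ (Fin n)

/-! ### Riemannian geometry in coordinates

A metric on a region of `ℝⁿ` is given by its matrix of components `G x i j = g_{ij}(x)`. -/

/-- The `i`-th coordinate vector. -/
def basisVec {n : ℕ} (i : Fin n) : E n := EuclideanSpace.single i 1

/-- `g_x(v, w)`. -/
def metricForm {n : ℕ} (G : E n → Matrix (Fin n) (Fin n) ℝ) (x v w : E n) : ℝ :=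
  ∑ i, ∑ j, G x i j * v i * w j

/-- The partial derivative `∂_i f` of a function defined near `x`. -/
def pderiv {n : ℕ} (i : Fin n) (f : E n → ℝ) (x : E n) : ℝ :=
  fderiv ℝ f x (basisVec i)

/-- The Christoffel symbol `Γ^k_{ij}` of the Levi-Civita connection. -/
def christoffel {n : ℕ} (G : E n → Matrix (Fin n) (Fin n) ℝ) (k i j : Fin n) (x : E n) : ℝ :=
  (1 / 2) * ∑ l, (G x)⁻¹ k l *
    (pderiv i (fun z => G z j l) x + pderiv j (fun z => G z i l) x
      - pderiv l (fun z => G z i j) x)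

/-- The components `R_{ij}` of the Ricci tensor (positive on round spheres). -/
def ricciComp {n : ℕ} (G : E n → Matrix (Fin n) (Fin n) ℝ) (i j : Fin n) (x : E n) : ℝ :=
  ∑ k, (pderiv k (christoffel G k i j) x - pderiv j (christoffel G k i k) x
    + ∑ l, (christoffel G k k l x * christoffel G l i j x
      - christoffel G k j l x * christoffel G l i k x))

/-- `Ric_x(v, w)`. -/
def ricci {n : ℕ} (G : E n → Matrix (Fin n) (Fin n) ℝ) (x v w : E n) : ℝ :=
  ∑ i, ∑ j, ricciComp G i j x * v i * w j

/-- The Levi-Civita derivative `∇_v Y` at `x`. -/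
def covDeriv {n : ℕ} (G : E n → Matrix (Fin n) (Fin n) ℝ) (Y : E n → E n) (x v : E n) : E n :=
  WithLp.toLp 2 fun k =>
    fderiv ℝ Y x v k + ∑ i, ∑ j, christoffel G k i j x * v i * Y x j

/-- The second fundamental form `A(v, w) = -g(∇_v ζ, w)` with respect to the unit normal
field `ζ`, for tangent vectors `v`, `w`. -/
def secondFundamentalForm {n : ℕ} (G : E n → Matrix (Fin n) (Fin n) ℝ) (ζ : E n → E n)
    (x v w : E n) : ℝ :=
  -metricForm G x (covDeriv G ζ x v) w

/-! ### Hypersurfaces in a chart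

A hypersurface of `ℝ^{d+1}` is described by a chart `φ` on a region of `ℝ^d`. -/

/-- The coordinate tangent vector `∂_i φ`. -/
def coordTangent {d n : ℕ} (φ : E d → E n) (i : Fin d) (y : E d) : E n :=
  fderiv ℝ φ y (basisVec i)

/-- The induced metric `h_{ij} = g(∂_i φ, ∂_j φ)`. -/
def inducedMetric {d n : ℕ} (G : E n → Matrix (Fin n) (Fin n) ℝ) (φ : E d → E n) (y : E d) :
    Matrix (Fin d) (Fin d) ℝ :=
  Matrix.of fun i j => metricForm G (φ y) (coordTangent φ i y) (coordTangent φ j y)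

/-- The squared norm `|A|² = h^{ik} h^{jl} A_{ij} A_{kl}` of the second fundamental form. -/
def normSqSecondFundamentalForm {d n : ℕ} (G : E n → Matrix (Fin n) (Fin n) ℝ)
    (φ : E d → E n) (ζ : E n → E n) (y : E d) : ℝ :=
  ∑ i, ∑ j, ∑ k, ∑ l,
    (inducedMetric G φ y)⁻¹ i k * (inducedMetric G φ y)⁻¹ j l *
      secondFundamentalForm G ζ (φ y) (coordTangent φ i y) (coordTangent φ j y) *
      secondFundamentalForm G ζ (φ y) (coordTangent φ k y) (coordTangent φ l y)

/-- The partial derivative `∂_i w` of a function `w` that is only given on `S`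
(one-sided at the boundary of `S`). -/
def pderivOn {d : ℕ} (S : Set (E d)) (i : Fin d) (w : E d → ℝ) (y : E d) : ℝ :=
  fderivWithin ℝ w S y (basisVec i)

/-- The density `√(det h)` of the Riemannian volume. -/
def volDensity {d : ℕ} (h : E d → Matrix (Fin d) (Fin d) ℝ) (y : E d) : ℝ :=
  Real.sqrt (h y).det

/-- The Laplace–Beltrami operator
`Δ_h w = (det h)^{-1/2} ∂_i ((det h)^{1/2} h^{ij} ∂_j w)` on `S`. -/
def laplaceBeltrami {d : ℕ} (h : E d → Matrix (Fin d) (Fin d) ℝ) (S : Set (E d))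
    (w : E d → ℝ) (y : E d) : ℝ :=
  (volDensity h y)⁻¹ *
    ∑ i, pderivOn S i (fun z => volDensity h z * ∑ j, (h z)⁻¹ i j * pderivOn S j w z) y

/-! ### The Schwarzschild space -/

/-- The horizon radius `R₀ = (m/2)^{1/(n-2)}`. -/
def horizonRadius (n : ℕ) (m : ℝ) : ℝ := (m / 2) ^ (1 / ((n : ℝ) - 2))

/-- The conformal factor `(1 + m / (2|x|^{n-2}))^{4/(n-2)}`. -/
def conformalFactor (n : ℕ) (m : ℝ) (x : E n) : ℝ :=
  (1 + m / (2 * ‖x‖ ^ (n - 2))) ^ (4 / ((n : ℝ) - 2))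

/-- The Riemannian Schwarzschild metric of mass `m`; the Schwarzschild space is the region
`|x| ≥ R₀` with this metric. -/
def schwarzschildMetric (n : ℕ) (m : ℝ) (x : E n) : Matrix (Fin n) (Fin n) ℝ :=
  conformalFactor n m x • (1 : Matrix (Fin n) (Fin n) ℝ)

/-- The unit normal `η` along the horizon `|x| = R₀` pointing into `|x| ≥ R₀`
(extended radially). -/
def horizonNormal (n : ℕ) (m : ℝ) (x : E n) : E n :=
  (Real.sqrt (conformalFactor n m x) * ‖x‖)⁻¹ • x

/-- The hypersurface `Σ₀ = {x_n = 0, |x| ≥ R₀}`, where `n = d + 1`. -/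
def Sigma0 (d : ℕ) (m : ℝ) : Set (E (d + 1)) :=
  {x | x (Fin.last d) = 0 ∧ horizonRadius (d + 1) m ≤ ‖x‖}

/-- `Σ(R) = Σ ∩ {|x| ≤ R}` for the rotated hypersurface `Σ = ρ(Σ₀)`. -/
def SigmaR (d : ℕ) (m : ℝ) (ρ : E (d + 1) ≃ₗᵢ[ℝ] E (d + 1)) (R : ℝ) : Set (E (d + 1)) :=
  (ρ '' Sigma0 d m) ∩ {x | ‖x‖ ≤ R}

/-- The unit normal field `ξ` of `ρ(Σ₀)`. -/
def normalField (d : ℕ) (m : ℝ) (ρ : E (d + 1) ≃ₗᵢ[ℝ] E (d + 1)) (x : E (d + 1)) : E (d + 1) :=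
  (Real.sqrt (conformalFactor (d + 1) m x))⁻¹ • ρ (basisVec (Fin.last d))

/-- The global chart `y ↦ ρ(y, 0)` of `ρ(Σ₀)`. -/
def chart (d : ℕ) (ρ : E (d + 1) ≃ₗᵢ[ℝ] E (d + 1)) (y : E d) : E (d + 1) :=
  ρ (WithLp.toLp 2 (Fin.snoc (α := fun _ => ℝ) (fun i => y i) 0))

/-- The closed annulus that corresponds to `Σ(R)` in the chart. -/
def annulus (d : ℕ) (m : ℝ) (R : ℝ) : Set (E d) :=
  {y | horizonRadius (d + 1) m ≤ ‖y‖ ∧ ‖y‖ ≤ R}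

theorem norm_snoc_zero (d : ℕ) (y : E d) :
    ‖(WithLp.toLp 2 (Fin.snoc (α := fun _ => ℝ) (fun i => y i) 0) : E (d + 1))‖ = ‖y‖ := by
  simp [EuclideanSpace.norm_eq, Fin.sum_univ_castSucc]

theorem norm_chart (d : ℕ) (ρ : E (d + 1) ≃ₗᵢ[ℝ] E (d + 1)) (y : E d) :
    ‖chart d ρ y‖ = ‖y‖ := by
  rw [chart, LinearIsometryEquiv.norm_map, norm_snoc_zero]

/-- The chart maps the annulus bijectively onto `Σ(R)`. -/
theorem chart_bijOn (d : ℕ) (m : ℝ) (ρ : E (d + 1) ≃ₗᵢ[ℝ] E (d + 1)) (R : ℝ) :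
    Set.BijOn (chart d ρ) (annulus d m R) (SigmaR d m ρ R) := by
  refine ⟨?_, ?_, ?_⟩
  · rintro y ⟨h1, h2⟩
    refine ⟨⟨_, ⟨?_, ?_⟩, rfl⟩, ?_⟩
    · simp
    · rw [norm_snoc_zero]; exact h1
    · simpa [norm_chart] using h2
  · intro y _ z _ h
    have h' := ρ.injective h
    ext i
    have := congrArg (fun v : E (d + 1) => v i.castSucc) h'
    simpa using this
  · rintro _ ⟨⟨x, ⟨hx0, hx1⟩, rfl⟩, hR⟩
    have hx : (WithLp.toLp 2 (Fin.snoc (α := fun _ => ℝ)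
        (fun i => (WithLp.toLp 2 (fun i : Fin d => x i.castSucc) : E d) i) 0) : E (d + 1)) = x := by
      ext i
      refine Fin.lastCases ?_ (fun i => ?_) i
      · simpa using hx0.symm
      · simp
    refine ⟨WithLp.toLp 2 (fun i => x i.castSucc), ⟨?_, ?_⟩, ?_⟩
    · rw [← norm_snoc_zero, hx]; exact hx1
    · rw [← norm_snoc_zero, hx]; simpa using hR
    · rw [chart, hx]

/-! ### The index form and the Morse index -/

open Classical in
/-- A function on `Σ(R)` written in the chart (the value off the annulus plays no role). -/
def inChart {d : ℕ} {m : ℝ} {ρ : E (d + 1) ≃ₗᵢ[ℝ] E (d + 1)} {R : ℝ}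
    (u : SigmaR d m ρ R → ℝ) (y : E d) : ℝ :=
  if h : chart d ρ y ∈ SigmaR d m ρ R then u ⟨chart d ρ y, h⟩ else 0

/-- The metric induced on `ρ(Σ₀)` by the Schwarzschild metric, in the chart. -/
def sigmaMetric (d : ℕ) (m : ℝ) (ρ : E (d + 1) ≃ₗᵢ[ℝ] E (d + 1)) :
    E d → Matrix (Fin d) (Fin d) ℝ :=
  inducedMetric (schwarzschildMetric (d + 1) m) (chart d ρ)

/-- The Jacobi operator `J u = Δ_Σ u + (Ric(ξ, ξ) + |A_Σ|²) u` on `Σ(R)`, in the chart. -/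
def jacobiOperator (d : ℕ) (m : ℝ) (ρ : E (d + 1) ≃ₗᵢ[ℝ] E (d + 1)) (R : ℝ)
    (w : E d → ℝ) (y : E d) : ℝ :=
  laplaceBeltrami (sigmaMetric d m ρ) (annulus d m R) w y +
    (ricci (schwarzschildMetric (d + 1) m) (chart d ρ y)
        (normalField d m ρ (chart d ρ y)) (normalField d m ρ (chart d ρ y)) +
      normSqSecondFundamentalForm (schwarzschildMetric (d + 1) m) (chart d ρ)
        (normalField d m ρ) y) * w y

/-- The Euclidean unit conormal (as a covector) of the sphere `∂Σ` in the chart, pointing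
out of `Σ`, that is, towards the origin. -/
def conormalCovector (d : ℕ) (y : E d) (i : Fin d) : ℝ := -(y i / ‖y‖)

/-- The length `(h^{ij} n_i n_j)^{1/2}` of the covector `n` above in the metric of `Σ`. -/
def conormalLength (d : ℕ) (m : ℝ) (ρ : E (d + 1) ≃ₗᵢ[ℝ] E (d + 1)) (y : E d) : ℝ :=
  Real.sqrt (∑ i, ∑ j, (sigmaMetric d m ρ y)⁻¹ i j * conormalCovector d y i *
    conormalCovector d y j)

/-- The derivative `∂w/∂ν` along the outward unit conormal
`ν^i = h^{ij} n_j / (h^{kl} n_k n_l)^{1/2}` of `∂Σ`. -/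
def conormalDeriv (d : ℕ) (m : ℝ) (ρ : E (d + 1) ≃ₗᵢ[ℝ] E (d + 1)) (R : ℝ)
    (w : E d → ℝ) (y : E d) : ℝ :=
  (conormalLength d m ρ y)⁻¹ *
    ∑ i, ∑ j, (sigmaMetric d m ρ y)⁻¹ i j * conormalCovector d y j *
      pderivOn (annulus d m R) i w y

/-- The integral over `∂Σ` of a function `F` given in the chart, against the Riemannian measure
`ds = (det h)^{1/2} (h^{ij} n_i n_j)^{1/2} dσ`, where `dσ` is the Euclidean surface measure of
the sphere of radius `R₀` in `ℝ^d`. -/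
def boundaryIntegral (d : ℕ) (m : ℝ) (ρ : E (d + 1) ≃ₗᵢ[ℝ] E (d + 1)) (F : E d → ℝ) : ℝ :=
  ∫ θ : Metric.sphere (0 : E d) 1,
    (fun y : E d => F y * (volDensity (sigmaMetric d m ρ) y * conormalLength d m ρ y))
        (horizonRadius (d + 1) m • (θ : E d)) * horizonRadius (d + 1) m ^ (d - 1)
      ∂(volume : Measure (E d)).toSphere

/-- The index form
`Q(u, u) = -∫_{Σ(R)} u J u dv + ∫_{∂Σ} u (∂u/∂ν - A_{∂M}(ξ, ξ) u) ds`. -/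
def indexForm (d : ℕ) (m : ℝ) (ρ : E (d + 1) ≃ₗᵢ[ℝ] E (d + 1)) (R : ℝ)
    (u : SigmaR d m ρ R → ℝ) : ℝ :=
  -(∫ y in annulus d m R,
      inChart u y * jacobiOperator d m ρ R (inChart u) y * volDensity (sigmaMetric d m ρ) y) +
    boundaryIntegral d m ρ (fun y =>
      inChart u y * (conormalDeriv d m ρ R (inChart u) y -
        secondFundamentalForm (schwarzschildMetric (d + 1) m) (horizonNormal (d + 1) m)
          (chart d ρ y) (normalField d m ρ (chart d ρ y)) (normalField d m ρ (chart d ρ y)) *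
        inChart u y))

/-- Functions on `Σ(R)` that are smooth up to the boundary and vanish on `|x| = R`. -/
def Admissible (d : ℕ) (m : ℝ) (ρ : E (d + 1) ≃ₗᵢ[ℝ] E (d + 1)) (R : ℝ)
    (u : SigmaR d m ρ R → ℝ) : Prop :=
  ContDiffOn ℝ ∞ (inChart u) (annulus d m R) ∧
    ∀ x : SigmaR d m ρ R, ‖(x : E (d + 1))‖ = R → u x = 0

/-- The Morse index of `Σ(R)` for functions vanishing on `|x| = R`: the maximal dimension of a
linear space of admissible functions on which the index form is negative definite. -/
def morseIndexR (d : ℕ) (m : ℝ) (ρ : E (d + 1) ≃ₗᵢ[ℝ] E (d + 1)) (R : ℝ) : ℕ∞ :=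
  ⨆ V ∈ {V : Submodule ℝ (SigmaR d m ρ R → ℝ) |
      (∀ u ∈ V, Admissible d m ρ R u) ∧ ∀ u ∈ V, u ≠ 0 → indexForm d m ρ R u < 0},
    Cardinal.toENat (Module.rank ℝ V)

/-- The Morse index of `ρ(Σ₀)` in the Schwarzschild space. -/
def morseIndex (d : ℕ) (m : ℝ) (ρ : E (d + 1) ≃ₗᵢ[ℝ] E (d + 1)) : ℕ∞ :=
  limsup (fun R : ℝ => morseIndexR d m ρ R) atTop

/-! ### Basic facts about the unit normals -/

theorem conformalFactor_pos (n : ℕ) (m : ℝ) (hm : 0 < m) (x : E n) :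
    0 < conformalFactor n m x := by
  unfold conformalFactor
  positivity

theorem metricForm_schwarzschild (n : ℕ) (m : ℝ) (x v w : E n) :
    metricForm (schwarzschildMetric n m) x v w = conformalFactor n m x * inner ℝ v w := by
  simp [metricForm, schwarzschildMetric, Matrix.one_apply, PiLp.inner_apply, Finset.mul_sum]
  exact Finset.sum_congr rfl fun i _ => by ring

/-- `ξ` has unit length. -/
theorem normalField_unit (d : ℕ) (m : ℝ) (hm : 0 < m) (ρ : E (d + 1) ≃ₗᵢ[ℝ] E (d + 1))
    (x : E (d + 1)) :
    metricForm (schwarzschildMetric (d + 1) m) x (normalField d m ρ x) (normalField d m ρ x)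
      = 1 := by
  have h := conformalFactor_pos (d + 1) m hm x
  rw [metricForm_schwarzschild, real_inner_self_eq_norm_sq, normalField, norm_smul,
    LinearIsometryEquiv.norm_map, mul_pow]
  simp [basisVec, Real.sq_sqrt h.le, h.ne']

/-- `ξ` is orthogonal to the hyperplane `ρ(ℝ^d × 0)`. -/
theorem normalField_orthogonal (d : ℕ) (m : ℝ) (ρ : E (d + 1) ≃ₗᵢ[ℝ] E (d + 1))
    (x : E (d + 1)) (y : E d) :
    metricForm (schwarzschildMetric (d + 1) m) x (normalField d m ρ x) (chart d ρ y) = 0 := by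
  rw [metricForm_schwarzschild, normalField, chart, real_inner_smul_left,
    LinearIsometryEquiv.inner_map_map, basisVec, EuclideanSpace.inner_single_left]
  simp

end Schwarzschild

end

/-!
In the flat coordinate `y` of `Σ` the metric is `e^{2φ} δ` with `φ = φ(|y|)`. Since `Σ` and the
horizon are totally geodesic, `Q(u, u)` is minus the integral of `u (div (P ∇u) + P V u)` over a
flat spherical shell, minus the radial flux of `u P ∇u` through the inner sphere; here
`P = e^{(n-3)φ}` and `V = e^{2φ} Ric(ξ, ξ)`.

Compare `u` with the reciprocal area radius `w = 1 / (r e^φ)`, and set `Y = -∇w / w = κ(r) y`.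
Integrating Picone's identity
`div (u (P ∇u + u P Y)) = u div (P ∇u) + P |∇u + u Y|² + u² (div (P Y) - P |Y|²)` turns `Q` into a
sum of nonnegative terms: scalar flatness gives the Riccati equation
`div (P Y) = P (V + (n - 3) |Y|²)`, the outer flux vanishes with `u`, and at the horizon the terms
in `Y` vanish because the area radius is critical there, i.e. `κ(R₀) = 0`.

The divergence theorem on the shell comes from the one for fields vanishing to first order at the
boundary: cutting off by radial functions shows that the flux through the sphere of radius `r` has
the integral of the divergence over that sphere as its weak derivative.
-/

noncomputable section

namespace Schwarzschild

section WeakDerivative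

open Set

variable {a b : ℝ}

theorem eqOn_zero_of_integral_mul_sq_eq_zero (hab : a < b) {p f : ℝ → ℝ}
    (hp : ContinuousOn p (Icc a b)) (hf : ContinuousOn f (Icc a b))
    (hp_nonneg : ∀ x ∈ Icc a b, 0 ≤ p x) (hp_pos : ∀ x ∈ Ioo a b, 0 < p x)
    (h : ∫ x in a..b, p x * f x ^ 2 = 0) : EqOn f 0 (Icc a b) := by
  have hinterior : EqOn f 0 (Ioo a b) := by
    intro x hx
    by_contra hne
    exact (intervalIntegral.integral_pos hab (hp.mul (hf.pow 2))
      (fun y hy => mul_nonneg (hp_nonneg y (Ioc_subset_Icc_self hy)) (sq_nonneg _))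
      ⟨x, Ioo_subset_Icc_self hx, mul_pos (hp_pos x hx) (sq_pos_of_ne_zero hne)⟩).ne' h
  exact hinterior.of_subset_closure hf continuousOn_const Ioo_subset_Icc_self
    (closure_Ioo hab.ne).ge

theorem integral_mul_eq_zero_of_forall_integral_deriv_mul_eq_zero {Ψ g : ℝ → ℝ}
    (h : ∀ χ : ℝ → ℝ, ContDiff ℝ 1 χ → χ a = 0 → χ b = 0 → deriv χ a = 0 → deriv χ b = 0 →
      ∫ x in a..b, deriv χ x * Ψ x = 0)
    (hg : Continuous g) (hga : g a = 0) (hgb : g b = 0) (hg_int : ∫ x in a..b, g x = 0) :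
    ∫ x in a..b, g x * Ψ x = 0 := by
  set χ : ℝ → ℝ := fun x => ∫ t in a..x, g t
  have hχ : ∀ x, HasDerivAt χ (g x) x := fun x => (hg.integral_hasStrictDerivAt a x).hasDerivAt
  have hderiv : deriv χ = g := funext fun x => (hχ x).deriv
  have hχ_smooth : ContDiff ℝ 1 χ :=
    contDiff_one_iff_deriv.2 ⟨fun x => (hχ x).differentiableAt, hderiv ▸ hg⟩
  simpa only [hderiv] using h χ hχ_smooth intervalIntegral.integral_same hg_int
    (by rw [hderiv, hga]) (by rw [hderiv, hgb])

theorem exists_eqOn_const_of_forall_integral_deriv_mul_eq_zero_of_continuous (hab : a < b)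
    {Ψ : ℝ → ℝ} (hΨ : Continuous Ψ)
    (h : ∀ χ : ℝ → ℝ, ContDiff ℝ 1 χ → χ a = 0 → χ b = 0 → deriv χ a = 0 → deriv χ b = 0 →
      ∫ x in a..b, deriv χ x * Ψ x = 0) :
    ∃ c, EqOn Ψ (fun _ => c) (Icc a b) := by
  -- Test against the primitive of `p * (Ψ - c)`, where the weight `p` vanishes at the endpoints
  -- and `c` is the `p`-weighted mean of `Ψ`.
  set p : ℝ → ℝ := fun x => (x - a) * (b - x) with hp
  have hp_cont : Continuous p := by fun_prop
  have hp_pos : ∀ x ∈ Ioo a b, 0 < p x := fun x hx =>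
    mul_pos (sub_pos.2 hx.1) (sub_pos.2 hx.2)
  have hp_nonneg : ∀ x ∈ Icc a b, 0 ≤ p x := fun x hx =>
    mul_nonneg (sub_nonneg.2 hx.1) (sub_nonneg.2 hx.2)
  have hp_int : 0 < ∫ x in a..b, p x :=
    intervalIntegral.intervalIntegral_pos_of_pos_on (hp_cont.intervalIntegrable _ _) hp_pos hab
  set c : ℝ := (∫ x in a..b, p x * Ψ x) / ∫ x in a..b, p x with hc
  set g : ℝ → ℝ := fun x => p x * (Ψ x - c) with hg
  have hg_cont : Continuous g := by fun_prop
  have hg_int : ∫ x in a..b, g x = 0 := by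
    simp only [hg, mul_sub]
    rw [intervalIntegral.integral_sub ((hp_cont.fun_mul hΨ).intervalIntegrable _ _)
      ((hp_cont.fun_mul continuous_const).intervalIntegrable _ _),
      intervalIntegral.integral_mul_const, hc]
    field_simp
    ring
  have horth : ∫ x in a..b, g x * Ψ x = 0 :=
    integral_mul_eq_zero_of_forall_integral_deriv_mul_eq_zero h hg_cont (by simp [hg, hp])
      (by simp [hg, hp]) hg_int
  have hsq : ∫ x in a..b, p x * (Ψ x - c) ^ 2 = 0 := by
    have hsplit : ∀ x, p x * (Ψ x - c) ^ 2 = g x * Ψ x - g x * c := fun x => by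
      simp only [hg]; ring
    simp only [hsplit]
    rw [intervalIntegral.integral_sub ((hg_cont.fun_mul hΨ).intervalIntegrable _ _)
      ((hg_cont.fun_mul continuous_const).intervalIntegrable _ _),
      intervalIntegral.integral_mul_const, hg_int, horth, zero_mul, sub_zero]
  exact ⟨c, fun x hx => sub_eq_zero.1 (eqOn_zero_of_integral_mul_sq_eq_zero hab
    hp_cont.continuousOn (hΨ.sub continuous_const).continuousOn hp_nonneg hp_pos hsq hx)⟩

theorem exists_eqOn_const_of_forall_integral_deriv_mul_eq_zero (hab : a < b) {Ψ : ℝ → ℝ}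
    (hΨ : ContinuousOn Ψ (Icc a b))
    (h : ∀ χ : ℝ → ℝ, ContDiff ℝ 1 χ → χ a = 0 → χ b = 0 → deriv χ a = 0 → deriv χ b = 0 →
      ∫ x in a..b, deriv χ x * Ψ x = 0) :
    ∃ c, EqOn Ψ (fun _ => c) (Icc a b) := by
  have hext : EqOn (IccExtend hab.le (domRestrict (Icc a b) Ψ)) Ψ (Icc a b) := fun x hx =>
    IccExtend_of_mem hab.le _ hx
  obtain ⟨c, hc⟩ := exists_eqOn_const_of_forall_integral_deriv_mul_eq_zero_of_continuous hab
    (continuousOn_iff_continuous_domRestrict.1 hΨ).Icc_extend' fun χ hχ ha hb ha' hb' => by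
      rw [← h χ hχ ha hb ha' hb']
      refine intervalIntegral.integral_congr fun x hx => ?_
      rw [uIcc_of_le hab.le] at hx
      simp only [hext hx]
  exact ⟨c, hext.symm.trans hc⟩

theorem sub_eq_integral_of_weak_deriv (hab : a < b) {Φ D : ℝ → ℝ}
    (hΦ : ContinuousOn Φ (Icc a b)) (hD : ContinuousOn D (Icc a b))
    (h : ∀ χ : ℝ → ℝ, ContDiff ℝ 1 χ → χ a = 0 → χ b = 0 → deriv χ a = 0 → deriv χ b = 0 →
      ∫ x in a..b, χ x * D x = -∫ x in a..b, deriv χ x * Φ x) :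
    Φ b - Φ a = ∫ x in a..b, D x := by
  have hD_int : IntervalIntegrable D volume a b := hD.intervalIntegrable_of_Icc hab.le
  have hprim_cont : ContinuousOn (fun x => ∫ t in a..x, D t) (Icc a b) :=
    (intervalIntegral.continuousOn_primitive_interval' hD_int left_mem_uIcc).mono Icc_subset_uIcc
  have hprim_deriv : ∀ x ∈ Ioo a b, HasDerivAt (fun x => ∫ t in a..x, D t) (D x) x := fun x hx =>
    intervalIntegral.integral_hasDerivAt_right
      (hD_int.mono_set (uIcc_subset_uIcc_left (Icc_subset_uIcc (Ioo_subset_Icc_self hx))))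
      ((hD.mono Ioo_subset_Icc_self).stronglyMeasurableAtFilter isOpen_Ioo x hx)
      (hD.continuousAt (Icc_mem_nhds hx.1 hx.2))
  obtain ⟨c, hc⟩ := exists_eqOn_const_of_forall_integral_deriv_mul_eq_zero hab
    (Ψ := fun x => Φ x - ∫ t in a..x, D t) (hΦ.sub hprim_cont) fun χ hχ ha hb ha' hb' => by
    have hχ' : Continuous (deriv χ) := hχ.continuous_deriv le_rfl
    have hparts := intervalIntegral.integral_mul_deriv_eq_deriv_mul_of_hasDerivAt
      (u := χ) (v := fun x => ∫ t in a..x, D t) hχ.continuous.continuousOn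
      (by rwa [uIcc_of_le hab.le])
      (fun x _ => (hχ.differentiable one_ne_zero x).hasDerivAt)
      (fun x hx => hprim_deriv x (by rwa [min_eq_left hab.le, max_eq_right hab.le] at hx))
      (hχ'.intervalIntegrable _ _) hD_int
    rw [ha, hb, h χ hχ ha hb ha' hb'] at hparts
    simp only [mul_sub]
    rw [intervalIntegral.integral_sub
      ((hχ'.continuousOn.fun_mul hΦ).intervalIntegrable_of_Icc hab.le)
      ((hχ'.continuousOn.fun_mul hprim_cont).intervalIntegrable_of_Icc hab.le)]
    linarith
  have ha := hc (left_mem_Icc.2 hab.le)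
  have hb := hc (right_mem_Icc.2 hab.le)
  simp only [intervalIntegral.integral_same] at ha hb
  linarith

end WeakDerivative

section VanishingBoundary

open Set

variable {F : Type*} [NormedAddCommGroup F] [NormedSpace ℝ F] {s : Set F} {f : F → ℝ}
  {f' : F → F →L[ℝ] ℝ}

theorem hasFDerivAt_indicator_of_eq_zero_on_frontier (hs : IsClosed s)
    (hf : ∀ x ∈ s, HasFDerivWithinAt f (f' x) s x) (hf_zero : ∀ x ∈ frontier s, f x = 0)
    (hf'_zero : ∀ x ∈ frontier s, f' x = 0) (x : F) :
    HasFDerivAt (s.indicator f) (s.indicator f' x) x := by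
  have hwithin : ∀ x ∈ s, HasFDerivWithinAt (s.indicator f) (f' x) s x := fun x hx =>
    (hf x hx).congr (fun _ hy => indicator_of_mem hy f) (indicator_of_mem hx f)
  have hcompl : ∀ x, s.indicator f x = 0 →
      HasFDerivWithinAt (s.indicator f) (0 : F →L[ℝ] ℝ) sᶜ x :=
    fun x hx => (hasFDerivWithinAt_const (0 : ℝ) x sᶜ).congr
      (fun _ hy => indicator_of_notMem hy f) hx
  by_cases hx : x ∈ s
  · rw [indicator_of_mem hx]
    by_cases hx' : x ∈ frontier s
    · have hout := hcompl x ((indicator_of_mem hx f).trans (hf_zero x hx'))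
      rw [← hf'_zero x hx'] at hout
      simpa only [union_compl_self, hasFDerivWithinAt_univ] using (hwithin x hx).union hout
    · exact (hwithin x hx).hasFDerivAt (mem_interior_iff_mem_nhds.1
        (not_not.1 fun hmem => hx' (hs.frontier_eq ▸ ⟨hx, hmem⟩)))
  · rw [indicator_of_notMem hx]
    exact (hcompl x (indicator_of_notMem hx f)).hasFDerivAt (hs.isOpen_compl.mem_nhds hx)

theorem setIntegral_fderiv_apply_eq_zero [FiniteDimensional ℝ F] [MeasurableSpace F]
    [BorelSpace F] {μ : Measure F} [μ.IsAddHaarMeasure] (hs : IsClosed s)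
    (hf : ∀ x ∈ s, HasFDerivWithinAt f (f' x) s x) (hf_zero : ∀ x ∈ frontier s, f x = 0)
    (hf'_zero : ∀ x ∈ frontier s, f' x = 0) (hf_int : IntegrableOn f s μ) {v : F}
    (hf'_int : IntegrableOn (fun x => f' x v) s μ) :
    ∫ x in s, f' x v ∂μ = 0 := by
  have hfderiv : ∀ x, fderiv ℝ (s.indicator f) x v = s.indicator (fun x => f' x v) x := fun x => by
    rw [(hasFDerivAt_indicator_of_eq_zero_on_frontier hs hf hf_zero hf'_zero x).fderiv]
    by_cases hx : x ∈ s <;> simp [hx]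
  have hparts := integral_mul_fderiv_eq_neg_fderiv_mul_of_integrable (μ := μ)
    (f := fun _ => (1 : ℝ)) (g := s.indicator f) (v := v) (by simp)
    (by simpa only [one_mul, hfderiv] using hf'_int.integrable_indicator hs.measurableSet)
    (by simpa only [one_mul] using hf_int.integrable_indicator hs.measurableSet)
    (fun x _ => differentiableAt_const _)
    (fun x _ => (hasFDerivAt_indicator_of_eq_zero_on_frontier hs hf hf_zero hf'_zero
      x).differentiableAt)
  simpa [hfderiv, integral_indicator hs.measurableSet] using hparts

end VanishingBoundary

section PolarCoordinates

open Set Metric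

/-- The integral of `f` over the sphere of radius `r` about the origin, with respect to the
surface measure induced by `μ`. -/
def sphereIntegral {F : Type*} [NormedAddCommGroup F] [NormedSpace ℝ F] [MeasurableSpace F]
    (μ : Measure F) (f : F → ℝ) (r : ℝ) : ℝ :=
  r ^ (Module.finrank ℝ F - 1) * ∫ θ : sphere (0 : F) 1, f (r • (θ : F)) ∂μ.toSphere

/-- The closed spherical shell between the radii `a` and `b`. -/
def shell {F : Type*} [Norm F] (a b : ℝ) : Set F := {y | a ≤ ‖y‖ ∧ ‖y‖ ≤ b}

variable {F : Type*} [NormedAddCommGroup F] {a b r : ℝ}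

theorem isClosed_shell : IsClosed (shell a b : Set F) :=
  (isClosed_le continuous_const continuous_norm).inter
    (isClosed_le continuous_norm continuous_const)

theorem ne_zero_of_mem_shell (ha : 0 < a) {y : F} (hy : y ∈ shell a b) : y ≠ 0 :=
  norm_pos_iff.1 (ha.trans_le hy.1)

theorem frontier_shell_subset : frontier (shell a b : Set F) ⊆ {y | ‖y‖ = a ∨ ‖y‖ = b} := by
  intro y hy
  have hmem := isClosed_shell.frontier_subset hy
  by_contra hne
  rw [mem_ofPred_eq, not_or] at hne
  have hopen : IsOpen {z : F | a < ‖z‖ ∧ ‖z‖ < b} :=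
    (isOpen_lt continuous_const continuous_norm).inter
      (isOpen_lt continuous_norm continuous_const)
  have hsub : {z : F | a < ‖z‖ ∧ ‖z‖ < b} ⊆ shell a b := fun _ hz => ⟨hz.1.le, hz.2.le⟩
  exact hy.2 (interior_maximal hsub hopen ⟨hmem.1.lt_of_ne' hne.1, hmem.2.lt_of_ne hne.2⟩)

variable [NormedSpace ℝ F]

theorem isCompact_shell [FiniteDimensional ℝ F] : IsCompact (shell a b : Set F) :=
  isCompact_of_isClosed_isBounded isClosed_shell
    ((isBounded_closedBall (x := (0 : F)) (r := b)).subset fun _ hy =>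
      mem_closedBall_zero_iff.2 hy.2)

theorem norm_smul_sphere (hr : 0 ≤ r) (θ : sphere (0 : F) 1) : ‖r • (θ : F)‖ = r := by
  rw [norm_smul, Real.norm_of_nonneg hr, norm_eq_of_mem_sphere, mul_one]

theorem smul_sphere_mem_shell_iff (hr : 0 ≤ r) (θ : sphere (0 : F) 1) :
    r • (θ : F) ∈ shell a b ↔ r ∈ Icc a b := by
  rw [shell, mem_ofPred_eq, norm_smul_sphere hr, mem_Icc]

variable [MeasurableSpace F] {μ : Measure F}

theorem sphereIntegral_congr {f g : F → ℝ} (hr : 0 ≤ r) (h : ∀ y, ‖y‖ = r → f y = g y) :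
    sphereIntegral μ f r = sphereIntegral μ g r := by
  simp only [sphereIntegral, h _ (norm_smul_sphere hr _)]

theorem sphereIntegral_comp_norm_mul {f : F → ℝ} (hr : 0 ≤ r) (χ : ℝ → ℝ) :
    sphereIntegral μ (fun y => χ ‖y‖ * f y) r = χ r * sphereIntegral μ f r := by
  simp only [sphereIntegral, norm_smul_sphere hr, integral_const_mul]
  ring

variable [FiniteDimensional ℝ F] [BorelSpace F] [μ.IsAddHaarMeasure]

theorem integral_eq_setIntegral_sphereIntegral [Nontrivial F] {f : F → ℝ}
    (hf : Integrable f μ) : ∫ y, f y ∂μ = ∫ r in Ioi 0, sphereIntegral μ f r := by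
  set g : sphere (0 : F) 1 × Ioi (0 : ℝ) → ℝ := fun q => f ((q.2 : ℝ) • (q.1 : F)) with hg
  set k := Module.finrank ℝ F - 1 with hk
  have hpolar := μ.measurePreserving_homeomorphUnitSphereProd
  have hemb := (homeomorphUnitSphereProd F).measurableEmbedding
  have hcomp : ∀ p : ({0}ᶜ : Set F), f p = g (homeomorphUnitSphereProd F p) := fun p => by
    have hp : (p : F) ≠ 0 := p.2
    simp [hg, smul_smul, hp]
  have hg_int : Integrable g (μ.toSphere.prod (.volumeIoiPow k)) := by
    rw [hk, ← hpolar.integrable_comp_emb hemb]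
    exact ((integrableOn_iff_comap_subtypeVal (measurableSet_singleton (0 : F)).compl).1
      hf.integrableOn).congr (.of_forall hcomp)
  calc ∫ y, f y ∂μ
      = ∫ p : ({0}ᶜ : Set F), f p ∂(μ.comap (↑)) := by
        rw [integral_subtype_comap (measurableSet_singleton _).compl f, restrict_compl_singleton]
    _ = ∫ q, g q ∂(μ.toSphere.prod (.volumeIoiPow k)) := by
        rw [← hpolar.integral_comp hemb]
        exact integral_congr_ae (.of_forall hcomp)
    _ = ∫ r, ∫ θ, g (θ, r) ∂μ.toSphere ∂(Measure.volumeIoiPow k) := integral_prod_symm _ hg_int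
    _ = ∫ r in Ioi 0, sphereIntegral μ f r := by
        simp only [Measure.volumeIoiPow, ENNReal.ofReal]
        rw [integral_withDensity_eq_integral_smul
            (measurable_subtype_coe.pow_const _).real_toNNReal,
          integral_subtype_comap measurableSet_Ioi fun r : ℝ =>
            Real.toNNReal (r ^ k) • ∫ θ : sphere (0 : F) 1, f (r • (θ : F)) ∂μ.toSphere]
        refine setIntegral_congr_fun measurableSet_Ioi fun r hr => ?_
        simp only [NNReal.smul_def, smul_eq_mul, sphereIntegral,
          Real.coe_toNNReal _ (pow_nonneg (le_of_lt hr) _), hk]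

theorem setIntegral_shell_eq_intervalIntegral [Nontrivial F] (ha : 0 < a) (hab : a ≤ b)
    {f : F → ℝ} (hf : ContinuousOn f (shell a b)) :
    ∫ y in shell a b, f y ∂μ = ∫ r in a..b, sphereIntegral μ f r := by
  have hmeas : MeasurableSet (shell a b : Set F) := isClosed_shell.measurableSet
  rw [← integral_indicator hmeas, integral_eq_setIntegral_sphereIntegral
    ((hf.integrableOn_compact isCompact_shell).integrable_indicator hmeas),
    intervalIntegral.integral_of_le hab, ← integral_Icc_eq_integral_Ioc]
  rw [setIntegral_eq_of_subset_of_forall_sdiff_eq_zero measurableSet_Ioi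
    (show Icc a b ⊆ Ioi 0 from fun r hr => ha.trans_le hr.1) fun r hr => ?_]
  · refine setIntegral_congr_fun measurableSet_Icc fun r hr => ?_
    have hr0 : 0 ≤ r := ha.le.trans hr.1
    exact sphereIntegral_congr hr0 fun y hy =>
      indicator_of_mem (show y ∈ shell a b from ⟨hy ▸ hr.1, hy ▸ hr.2⟩) f
  · simp [sphereIntegral, (smul_sphere_mem_shell_iff (le_of_lt hr.1) _).not.2 hr.2]

theorem continuousOn_sphereIntegral (ha : 0 ≤ a) {f : F → ℝ} (hf : ContinuousOn f (shell a b)) :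
    ContinuousOn (sphereIntegral μ f) (Icc a b) := by
  refine (continuousOn_pow _).mul (continuousOn_iff_continuous_domRestrict.2 ?_)
  have hcont : Continuous (Function.uncurry fun (r : Icc a b) (θ : sphere (0 : F) 1) =>
      f ((r : ℝ) • (θ : F))) :=
    hf.comp_continuous (by fun_prop) fun p =>
      (smul_sphere_mem_shell_iff (ha.trans p.1.2.1) p.2).2 p.1.2
  simpa only [Measure.restrict_univ, domRestrict_def] using
    continuous_parametric_integral_of_continuous (μ := μ.toSphere) hcont isCompact_univ

end PolarCoordinates

section Divergence

open Set Metric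
open scoped InnerProductSpace

section RadialFunctions

variable {F : Type*} [NormedAddCommGroup F] [InnerProductSpace ℝ F] {a b : ℝ}

theorem hasGradientAt_comp_norm [CompleteSpace F] {g : ℝ → ℝ} {g' : ℝ} {x : F} (hx : x ≠ 0)
    (hg : HasDerivAt g g' ‖x‖) : HasGradientAt (fun z => g ‖z‖) ((g' / ‖x‖) • x) x := by
  have hnorm : HasFDerivAt (fun z : F => ‖z‖) (‖x‖⁻¹ • innerSL ℝ x) x := by
    have hsqrt := (hasStrictFDerivAt_norm_sq x).hasFDerivAt.sqrt
      (pow_ne_zero 2 (norm_ne_zero_iff.2 hx))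
    simp only [Real.sqrt_sq (norm_nonneg _)] at hsqrt
    refine hsqrt.congr_fderiv ?_
    rw [two_smul, ← two_smul ℝ (innerSL ℝ x), smul_smul]
    congr 1
    field_simp
  refine hasGradientAt_iff_hasFDerivAt.2 ((hg.comp_hasFDerivAt x hnorm).congr_fderiv ?_)
  ext v
  simp [div_eq_mul_inv, mul_assoc]

theorem uniqueDiffOn_shell (ha : 0 < a) (hab : a < b) : UniqueDiffOn ℝ (shell a b : Set F) := by
  intro y hy
  rcases hy.2.lt_or_eq with hlt | heq
  · -- Near `y` the shell contains the half-space tangent at `y` to the sphere through `y`.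
    have hy_pos : 0 < ‖y‖ := ha.trans_le hy.1
    have hconvex : Convex ℝ {z : F | ‖y‖ ^ 2 ≤ ⟪y, z⟫_ℝ} :=
      convex_halfSpace_ge (innerSL ℝ y).isLinear _
    have hopen : IsOpen {z : F | ‖y‖ ^ 2 < ⟪y, z⟫_ℝ} :=
      isOpen_lt continuous_const (innerSL ℝ y).continuous
    have hinterior : (interior {z : F | ‖y‖ ^ 2 ≤ ⟪y, z⟫_ℝ}).Nonempty := by
      have hsub : {z : F | ‖y‖ ^ 2 < ⟪y, z⟫_ℝ} ⊆ {z : F | ‖y‖ ^ 2 ≤ ⟪y, z⟫_ℝ} :=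
        fun z (hz : ‖y‖ ^ 2 < ⟪y, z⟫_ℝ) => (hz.le : ‖y‖ ^ 2 ≤ ⟪y, z⟫_ℝ)
      refine ⟨(2 : ℝ) • y, interior_maximal hsub hopen ?_⟩
      rw [mem_ofPred_eq, inner_smul_right, real_inner_self_eq_norm_sq]
      linarith [pow_pos hy_pos 2]
    have hhalf : UniqueDiffWithinAt ℝ {z : F | ‖y‖ ^ 2 ≤ ⟪y, z⟫_ℝ} y :=
      uniqueDiffWithinAt_convex hconvex hinterior (subset_closure (by simp))
    refine (hhalf.inter (isOpen_ball.mem_nhds (mem_ball_zero_iff.2 hlt))).mono ?_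
    rintro z ⟨hz, hzb⟩
    refine ⟨hy.1.trans (le_of_mul_le_mul_left ?_ hy_pos), (mem_ball_zero_iff.1 hzb).le⟩
    exact (sq ‖y‖).symm.le.trans (le_trans hz (real_inner_le_norm y z))
  · have hball : UniqueDiffWithinAt ℝ (closedBall (0 : F) b) y :=
      uniqueDiffWithinAt_convex (convex_closedBall _ _)
        ⟨0, ball_subset_interior_closedBall (mem_ball_self (ha.trans hab))⟩
        (subset_closure (mem_closedBall_zero_iff.2 heq.le))
    refine (hball.inter ((isOpen_lt continuous_const continuous_norm).mem_nhds
      (show a < ‖y‖ from heq ▸ hab))).mono fun z hz => ?_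
    exact ⟨le_of_lt hz.2, mem_closedBall_zero_iff.1 hz.1⟩

theorem contDiffOn_comp_norm_shell {k : WithTop ℕ∞} (ha : 0 < a) {g : ℝ → ℝ}
    (hg : ∀ r, 0 < r → ContDiffAt ℝ k g r) :
    ContDiffOn ℝ k (fun z : F => g ‖z‖) (shell a b) := fun z hz =>
  ((hg ‖z‖ (ha.trans_le hz.1)).comp z
    (contDiffAt_norm ℝ (ne_zero_of_mem_shell ha hz))).contDiffWithinAt

theorem continuousOn_inner_div_norm (ha : 0 < a) {X : F → F}
    (hX : ContinuousOn X (shell a b)) :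
    ContinuousOn (fun y => ⟪y, X y⟫_ℝ / ‖y‖) (shell a b) :=
  (continuousOn_id.inner hX).div continuous_norm.continuousOn
    fun _ hy => norm_ne_zero_iff.2 (ne_zero_of_mem_shell ha hy)

end RadialFunctions

section VectorFields

variable {d : ℕ} {S : Set (E d)} {y : E d}

/-- The Euclidean divergence of a vector field that is only given on `S` (one-sided at the
boundary of `S`). -/
def divergenceOn (S : Set (E d)) (X : E d → E d) (y : E d) : ℝ :=
  ∑ i, pderivOn S i (fun z => X z i) y

theorem gradientWithin_apply (f : E d → ℝ) (i : Fin d) :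
    gradientWithin f S y i = pderivOn S i f y := by
  rw [pderivOn, ← inner_gradientWithin_left, basisVec, EuclideanSpace.inner_single_right]
  simp

theorem pderivOn_mul {f g : E d → ℝ} (hS : UniqueDiffWithinAt ℝ S y)
    (hf : DifferentiableWithinAt ℝ f S y) (hg : DifferentiableWithinAt ℝ g S y) (i : Fin d) :
    pderivOn S i (fun z => f z * g z) y = f y * pderivOn S i g y + pderivOn S i f y * g y := by
  simp [pderivOn, fderivWithin_fun_mul hS hf hg, mul_comm]

theorem differentiableWithinAt_apply {X : E d → E d} (hX : DifferentiableWithinAt ℝ X S y)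
    (i : Fin d) : DifferentiableWithinAt ℝ (fun z => X z i) S y :=
  differentiableWithinAt_euclidean.1 hX i

theorem divergenceOn_add {X Y : E d → E d} (hS : UniqueDiffWithinAt ℝ S y)
    (hX : DifferentiableWithinAt ℝ X S y) (hY : DifferentiableWithinAt ℝ Y S y) :
    divergenceOn S (fun z => X z + Y z) y = divergenceOn S X y + divergenceOn S Y y := by
  simp only [divergenceOn, pderivOn, PiLp.add_apply, ← Finset.sum_add_distrib]
  refine Finset.sum_congr rfl fun i _ => ?_
  rw [fderivWithin_fun_add hS (differentiableWithinAt_apply hX i)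
    (differentiableWithinAt_apply hY i), add_apply]

theorem divergenceOn_smul {f : E d → ℝ} {X : E d → E d} (hS : UniqueDiffWithinAt ℝ S y)
    (hf : DifferentiableWithinAt ℝ f S y) (hX : DifferentiableWithinAt ℝ X S y) :
    divergenceOn S (fun z => f z • X z) y =
      f y * divergenceOn S X y + ⟪gradientWithin f S y, X y⟫_ℝ := by
  simp only [divergenceOn, PiLp.smul_apply, smul_eq_mul, PiLp.inner_apply, gradientWithin_apply,
    pderivOn_mul hS hf (differentiableWithinAt_apply hX _), Finset.sum_add_distrib,
    Finset.mul_sum, RCLike.inner_apply, conj_trivial, mul_comm]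

theorem divergenceOn_id (hS : UniqueDiffWithinAt ℝ S y) :
    divergenceOn S (fun z => z) y = d := by
  have hcoord : ∀ i, pderivOn S i (fun z : E d => z i) y = 1 := fun i => by
    have hproj : HasFDerivWithinAt (fun z : E d => z i)
        (EuclideanSpace.proj i : E d →L[ℝ] ℝ) S y :=
      (EuclideanSpace.proj i : E d →L[ℝ] ℝ).hasFDerivWithinAt
    rw [pderivOn, hproj.fderivWithin hS]
    simp [basisVec]
  simp [divergenceOn, hcoord]

theorem continuousOn_divergenceOn (hS : UniqueDiffOn ℝ S) {X : E d → E d}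
    (hX : ContDiffOn ℝ 1 X S) : ContinuousOn (divergenceOn S X) S :=
  continuousOn_finsetSum _ fun i _ =>
    ((contDiffOn_euclidean.1 hX i).continuousOn_fderivWithin hS le_rfl).clm_apply
      continuousOn_const

theorem contDiffOn_gradientWithin (hS : UniqueDiffOn ℝ S) {k : WithTop ℕ∞} {f : E d → ℝ}
    (hf : ContDiffOn ℝ (k + 1) f S) : ContDiffOn ℝ k (gradientWithin f S) S :=
  (InnerProductSpace.toDual ℝ (E d)).symm.contDiff.comp_contDiffOn (hf.fderivWithin hS le_rfl)

theorem setIntegral_divergenceOn_eq_zero (hS : IsCompact S) (hS' : UniqueDiffOn ℝ S)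
    {X : E d → E d} (hX : ContDiffOn ℝ 1 X S) (hX_zero : ∀ y ∈ frontier S, X y = 0)
    (hX'_zero : ∀ y ∈ frontier S, fderivWithin ℝ X S y = 0) :
    ∫ y in S, divergenceOn S X y = 0 := by
  have hcoord : ∀ i, ContDiffOn ℝ 1 (fun z => X z i) S := contDiffOn_euclidean.1 hX
  have hcoord_zero : ∀ i, ∀ y ∈ frontier S, fderivWithin ℝ (fun z => X z i) S y = 0 :=
    fun i y hy => by
      have hyS := hS.isClosed.frontier_subset hy
      have hXy := (hX.differentiableOn one_ne_zero y hyS).hasFDerivWithinAt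
      rw [hX'_zero y hy] at hXy
      have hproj := (EuclideanSpace.proj (𝕜 := ℝ) i).hasFDerivAt.comp_hasFDerivWithinAt y hXy
      exact (hproj.fderivWithin (hS' y hyS)).trans (ContinuousLinearMap.comp_zero _)
  have hint : ∀ i, IntegrableOn (pderivOn S i fun z => X z i) S := fun i =>
    (((hcoord i).continuousOn_fderivWithin hS' le_rfl).clm_apply
      continuousOn_const).integrableOn_compact hS
  simp only [divergenceOn]
  rw [integral_finsetSum _ fun i _ => hint i]
  exact Finset.sum_eq_zero fun i _ => setIntegral_fderiv_apply_eq_zero hS.isClosed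
    (fun y hy => ((hcoord i).differentiableOn one_ne_zero y hy).hasFDerivWithinAt)
    (fun y hy => by rw [hX_zero y hy]; rfl) (hcoord_zero i)
    ((hcoord i).continuousOn.integrableOn_compact hS) (hint i)

end VectorFields

variable {d : ℕ} {a b : ℝ}

theorem gradientWithin_comp_norm_shell (ha : 0 < a) (hab : a < b) {g : ℝ → ℝ} {g' : ℝ} {y : E d}
    (hy : y ∈ shell a b) (hg : HasDerivAt g g' ‖y‖) :
    gradientWithin (fun z => g ‖z‖) (shell a b) y = (g' / ‖y‖) • y := by
  rw [gradientWithin, ((hasGradientAt_comp_norm (ne_zero_of_mem_shell ha hy)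
    hg).hasFDerivAt.hasFDerivWithinAt).fderivWithin (uniqueDiffOn_shell ha hab y hy),
    LinearIsometryEquiv.symm_apply_apply]

theorem divergenceOn_comp_norm_smul_shell (ha : 0 < a) (hab : a < b)
    {g : ℝ → ℝ} {g' : ℝ} {y : E d} (hy : y ∈ shell a b) (hg : HasDerivAt g g' ‖y‖) :
    divergenceOn (shell a b) (fun z => g ‖z‖ • z) y = d * g ‖y‖ + ‖y‖ * g' := by
  have hunique := uniqueDiffOn_shell ha hab y hy
  have hy0 := ne_zero_of_mem_shell ha hy
  rw [divergenceOn_smul hunique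
    (hasGradientAt_comp_norm hy0 hg).hasFDerivAt.differentiableAt.differentiableWithinAt
    differentiableWithinAt_fun_id, divergenceOn_id hunique,
    gradientWithin_comp_norm_shell ha hab hy hg, real_inner_smul_left, real_inner_self_eq_norm_sq]
  field_simp

theorem integral_comp_norm_mul_divergenceOn (ha : 0 < a) (hab : a < b) {X : E d → E d}
    (hX : ContDiffOn ℝ 1 X (shell a b)) {χ : ℝ → ℝ} (hχ : ContDiff ℝ 1 χ) (hχa : χ a = 0)
    (hχb : χ b = 0) (hχa' : deriv χ a = 0) (hχb' : deriv χ b = 0) :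
    ∫ y in shell a b, χ ‖y‖ * divergenceOn (shell a b) X y =
      -∫ y in shell a b, deriv χ ‖y‖ * (⟪y, X y⟫_ℝ / ‖y‖) := by
  have hunique := uniqueDiffOn_shell (F := E d) ha hab
  have hχ_deriv : ∀ r, HasDerivAt χ (deriv χ r) r := fun r =>
    (hχ.differentiable one_ne_zero r).hasDerivAt
  have hχ_norm : ContDiffOn ℝ 1 (fun y : E d => χ ‖y‖) (shell a b) :=
    contDiffOn_comp_norm_shell ha fun _ _ => hχ.contDiffAt
  have hdiv : ∀ y ∈ shell a b, divergenceOn (shell a b) (fun z => χ ‖z‖ • X z) y =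
      χ ‖y‖ * divergenceOn (shell a b) X y + deriv χ ‖y‖ * (⟪y, X y⟫_ℝ / ‖y‖) := fun y hy => by
    rw [divergenceOn_smul (hunique y hy) (hχ_norm.differentiableOn one_ne_zero y hy)
      (hX.differentiableOn one_ne_zero y hy),
      gradientWithin_comp_norm_shell ha hab hy (hχ_deriv _), real_inner_smul_left]
    ring
  have hzero : ∫ y in shell a b, divergenceOn (shell a b) (fun z => χ ‖z‖ • X z) y = 0 := by
    refine setIntegral_divergenceOn_eq_zero isCompact_shell hunique (hχ_norm.smul hX) ?_ ?_ <;>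
      intro y hy
    · rcases frontier_shell_subset hy with h | h <;> simp [h, hχa, hχb]
    · have hyS := isClosed_shell.frontier_subset hy
      rw [fderivWithin_fun_smul (hunique y hyS) (hχ_norm.differentiableOn one_ne_zero y hyS)
        (hX.differentiableOn one_ne_zero y hyS), ((hasGradientAt_comp_norm
          (ne_zero_of_mem_shell ha hyS) (hχ_deriv ‖y‖)).hasFDerivAt.hasFDerivWithinAt).fderivWithin
          (hunique y hyS)]
      rcases frontier_shell_subset hy with h | h <;> simp [h, hχa, hχb, hχa', hχb']
  rw [setIntegral_congr_fun isClosed_shell.measurableSet hdiv, integral_add] at hzero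
  · linarith
  · exact (hχ_norm.continuousOn.fun_mul
      (continuousOn_divergenceOn hunique hX)).integrableOn_compact isCompact_shell
  · have hχ'_norm : Continuous fun y : E d => deriv χ ‖y‖ :=
      (hχ.continuous_deriv le_rfl).comp continuous_norm
    exact (hχ'_norm.continuousOn.fun_mul
      (continuousOn_inner_div_norm ha hX.continuousOn)).integrableOn_compact isCompact_shell

theorem integral_divergenceOn_shell [NeZero d] (ha : 0 < a) (hab : a < b) {X : E d → E d}
    (hX : ContDiffOn ℝ 1 X (shell a b)) :
    ∫ y in shell a b, divergenceOn (shell a b) X y =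
      sphereIntegral volume (fun y => ⟪y, X y⟫_ℝ / ‖y‖) b -
        sphereIntegral volume (fun y => ⟪y, X y⟫_ℝ / ‖y‖) a := by
  have hdiv := continuousOn_divergenceOn (uniqueDiffOn_shell ha hab) hX
  have hflux := continuousOn_inner_div_norm ha hX.continuousOn
  have hpolar : ∀ (χ : ℝ → ℝ) (f : E d → ℝ), Continuous χ → ContinuousOn f (shell a b) →
      ∫ y in shell a b, χ ‖y‖ * f y = ∫ r in a..b, χ r * sphereIntegral volume f r := by
    intro χ f hχ hf
    have hχ_norm : Continuous fun y : E d => χ ‖y‖ := hχ.comp continuous_norm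
    rw [setIntegral_shell_eq_intervalIntegral ha hab.le (hχ_norm.continuousOn.fun_mul hf)]
    refine intervalIntegral.integral_congr fun r hr => ?_
    rw [uIcc_of_le hab.le] at hr
    exact sphereIntegral_comp_norm_mul (ha.le.trans hr.1) χ
  rw [setIntegral_shell_eq_intervalIntegral ha hab.le hdiv]
  refine (sub_eq_integral_of_weak_deriv hab (continuousOn_sphereIntegral ha.le hflux)
    (continuousOn_sphereIntegral ha.le hdiv) fun χ hχ hχa hχb hχa' hχb' => ?_).symm
  rw [← hpolar χ _ hχ.continuous hdiv, ← hpolar (deriv χ) _ (hχ.continuous_deriv le_rfl) hflux]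
  exact integral_comp_norm_mul_divergenceOn ha hab hX hχ hχa hχb hχa' hχb'

end Divergence

section Picone

open Set
open scoped InnerProductSpace

variable {d : ℕ}

theorem divergenceOn_picone {S : Set (E d)} {y : E d} {P u : E d → ℝ} {Y : E d → E d}
    (hS : UniqueDiffWithinAt ℝ S y) (hP : DifferentiableWithinAt ℝ P S y)
    (hY : DifferentiableWithinAt ℝ Y S y) (hu : DifferentiableWithinAt ℝ u S y)
    (hu' : DifferentiableWithinAt ℝ (gradientWithin u S) S y) :
    divergenceOn S (fun z => u z • (P z • gradientWithin u S z + u z • P z • Y z)) y =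
      u y * divergenceOn S (fun z => P z • gradientWithin u S z) y +
        P y * ‖gradientWithin u S y + u y • Y y‖ ^ 2 +
        u y ^ 2 * (divergenceOn S (fun z => P z • Y z) y - P y * ‖Y y‖ ^ 2) := by
  have hPu := hP.fun_smul hu'
  have hPY := hP.fun_smul hY
  rw [divergenceOn_smul hS hu (hPu.fun_add (hu.fun_smul hPY)),
    divergenceOn_add hS hPu (hu.fun_smul hPY), divergenceOn_smul hS hu hPY, norm_add_sq_real,
    inner_add_right, norm_smul, mul_pow, Real.norm_eq_abs, sq_abs]
  simp only [real_inner_smul_right, real_inner_self_eq_norm_sq]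
  ring

theorem nonneg_of_barrier_shell [NeZero d] {a b : ℝ} (ha : 0 < a) (hab : a < b)
    {P V u : E d → ℝ} {Y : E d → E d} (hP : ContDiffOn ℝ 1 P (shell a b))
    (hP_nonneg : ∀ y ∈ shell a b, 0 ≤ P y) (hV : ContinuousOn V (shell a b))
    (hY : ContDiffOn ℝ 1 Y (shell a b))
    (hY_div : ∀ y ∈ shell a b,
      P y * ‖Y y‖ ^ 2 + V y ≤ divergenceOn (shell a b) (fun z => P z • Y z) y)
    (hY_inner : ∀ y, ‖y‖ = a → ⟪y, Y y⟫_ℝ = 0)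
    (hu : ContDiffOn ℝ 2 u (shell a b)) (hu_outer : ∀ y, ‖y‖ = b → u y = 0) :
    0 ≤ -(∫ y in shell a b, u y * (divergenceOn (shell a b)
          (fun z => P z • gradientWithin u (shell a b) z) y + V y * u y)) -
      sphereIntegral volume
        (fun y => u y * (P y * (⟪y, gradientWithin u (shell a b) y⟫_ℝ / ‖y‖))) a := by
  set S : Set (E d) := shell a b
  have hunique : UniqueDiffOn ℝ S := uniqueDiffOn_shell ha hab
  have hu1 : ContDiffOn ℝ 1 u S := hu.of_le one_le_two
  have hu' : ContDiffOn ℝ 1 (gradientWithin u S) S := contDiffOn_gradientWithin hunique hu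
  set X : E d → E d := fun z => u z • (P z • gradientWithin u S z + u z • P z • Y z) with hX_def
  have hX : ContDiffOn ℝ 1 X S := hu1.smul ((hP.smul hu').add (hu1.smul (hP.smul hY)))
  have hle : ∀ y ∈ S, u y * (divergenceOn S (fun z => P z • gradientWithin u S z) y + V y * u y) ≤
      divergenceOn S X y := fun y hy => by
    rw [hX_def, divergenceOn_picone (hunique y hy) (hP.differentiableOn one_ne_zero y hy)
      (hY.differentiableOn one_ne_zero y hy) (hu1.differentiableOn one_ne_zero y hy)
      (hu'.differentiableOn one_ne_zero y hy)]
    linarith [mul_nonneg (hP_nonneg y hy) (sq_nonneg ‖gradientWithin u S y + u y • Y y‖),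
      mul_le_mul_of_nonneg_left (hY_div y hy) (sq_nonneg (u y))]
  have hcont : ContinuousOn (fun y => u y * (divergenceOn S
      (fun z => P z • gradientWithin u S z) y + V y * u y)) S :=
    hu.continuousOn.fun_mul ((continuousOn_divergenceOn hunique (hP.smul hu')).fun_add
      (hV.fun_mul hu.continuousOn))
  have hmono := setIntegral_mono_on (μ := volume) (hcont.integrableOn_compact isCompact_shell)
    ((continuousOn_divergenceOn hunique hX).integrableOn_compact isCompact_shell)
    isClosed_shell.measurableSet hle
  have houter : sphereIntegral volume (fun y => ⟪y, X y⟫_ℝ / ‖y‖) b = 0 := by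
    rw [sphereIntegral_congr (g := fun _ => 0) (ha.trans hab).le fun y hy => by
      simp [hX_def, hu_outer y hy]]
    simp [sphereIntegral]
  have hinner : sphereIntegral volume (fun y => ⟪y, X y⟫_ℝ / ‖y‖) a =
      sphereIntegral volume (fun y => u y * (P y * (⟪y, gradientWithin u S y⟫_ℝ / ‖y‖))) a :=
    sphereIntegral_congr ha.le fun y hy => by
      simp only [hX_def, real_inner_smul_right, inner_add_right, hY_inner y hy]
      ring
  rw [integral_divergenceOn_shell ha hab hX, houter, hinner] at hmono
  linarith

end Picone

section ConformallyFlat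

open Topology
open scoped InnerProductSpace Matrix

variable {n : ℕ} {φ : E n → ℝ} {x : E n}

/-- The conformally flat metric `e^{2φ} δ`. -/
def conformalMetric (φ : E n → ℝ) (x : E n) : Matrix (Fin n) (Fin n) ℝ :=
  Real.exp (2 * φ x) • 1

/-- The Christoffel symbols `Γ^k_{ij}` of `e^{2φ} δ` as a matrix in `k`, `j`, where `f = ∇φ`. -/
def conformalChristoffel (f : Fin n → ℝ) (i : Fin n) : Matrix (Fin n) (Fin n) ℝ :=
  f i • 1 + Matrix.vecMulVec (Pi.single i 1) f - Matrix.vecMulVec f (Pi.single i 1)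

theorem conformalChristoffel_apply (f : Fin n → ℝ) (i j k : Fin n) :
    conformalChristoffel f i k j =
      (1 : Matrix (Fin n) (Fin n) ℝ) k j * f i + (1 : Matrix (Fin n) (Fin n) ℝ) k i * f j -
        (1 : Matrix (Fin n) (Fin n) ℝ) i j * f k := by
  simp only [conformalChristoffel, Matrix.sub_apply, Matrix.add_apply, Matrix.smul_apply,
    Matrix.vecMulVec_apply, Matrix.one_apply, Pi.single_apply, smul_eq_mul, eq_comm (a := j)]
  ring

theorem conformalChristoffel_comm (f : Fin n → ℝ) (i j k : Fin n) :
    conformalChristoffel f i k j = conformalChristoffel f j k i := by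
  rw [conformalChristoffel_apply, conformalChristoffel_apply, ← Matrix.transpose_apply 1 i j,
    Matrix.transpose_one]
  ring

theorem trace_conformalChristoffel (f : Fin n → ℝ) (i : Fin n) :
    (conformalChristoffel f i).trace = n * f i := by
  simp [conformalChristoffel, Matrix.trace_vecMulVec, mul_comm]

theorem dotProduct_conformalChristoffel (f : Fin n → ℝ) (i j : Fin n) :
    ∑ l, f l * conformalChristoffel f i l j =
      2 * (f i * f j) - (1 : Matrix (Fin n) (Fin n) ℝ) i j * (f ⬝ᵥ f) := by
  change (f ᵥ* conformalChristoffel f i) j = _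
  simp only [conformalChristoffel, Matrix.vecMul_sub, Matrix.vecMul_add, Matrix.vecMul_smul,
    Matrix.vecMul_one, Matrix.vecMul_vecMulVec, dotProduct_single_one, Pi.sub_apply,
    Pi.add_apply, Pi.smul_apply, Pi.single_apply, smul_eq_mul, Matrix.one_apply,
    eq_comm (a := j)]
  ring

theorem conformalChristoffel_mulVec (f w : Fin n → ℝ) (i k : Fin n) :
    (conformalChristoffel f i *ᵥ w) k =
      f i * w k + (1 : Matrix (Fin n) (Fin n) ℝ) k i * (f ⬝ᵥ w) - f k * w i := by
  simp only [conformalChristoffel, Matrix.sub_mulVec, Matrix.add_mulVec, Matrix.smul_mulVec,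
    Matrix.one_mulVec, Matrix.vecMulVec_mulVec, single_one_dotProduct, Pi.sub_apply,
    Pi.add_apply, Pi.smul_apply, Pi.single_apply, smul_eq_mul, Matrix.one_apply,
    MulOpposite.smul_eq_mul_unop, MulOpposite.unop_op]

theorem trace_conformalChristoffel_mul (f : Fin n → ℝ) (i j : Fin n) :
    (conformalChristoffel f i * conformalChristoffel f j).trace =
      (n + 2) * (f i * f j) - 2 * ((1 : Matrix (Fin n) (Fin n) ℝ) i j * (f ⬝ᵥ f)) := by
  simp only [conformalChristoffel, sub_mul, add_mul, mul_sub, mul_add, smul_mul_assoc,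
    mul_smul_comm, one_mul, mul_one, Matrix.vecMulVec_mul_vecMulVec, Matrix.vecMulVec_smul,
    Matrix.trace_sub, Matrix.trace_add, Matrix.trace_smul, Matrix.trace_vecMulVec,
    Matrix.trace_one, Fintype.card_fin, smul_eq_mul, single_one_dotProduct,
    dotProduct_single_one, Pi.single_apply, Matrix.one_apply, eq_comm (a := j)]
  ring

theorem smul_one_inv {ι K : Type*} [Fintype ι] [DecidableEq ι] [Field K] {c : K} (hc : c ≠ 0) :
    (c • (1 : Matrix ι ι K))⁻¹ = c⁻¹ • 1 :=
  Matrix.inv_eq_right_inv (by simp [smul_smul, hc])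

theorem pderiv_eq_of_hasGradientAt {g : E n} (h : HasGradientAt φ g x) (i : Fin n) :
    pderiv i φ x = g i := by
  rw [pderiv, h.hasFDerivAt.fderiv, InnerProductSpace.toDual_apply_apply, basisVec,
    EuclideanSpace.inner_single_right]
  simp

theorem christoffel_conformalMetric {g : E n} (h : HasGradientAt φ g x) (k i j : Fin n) :
    christoffel (conformalMetric φ) k i j x = conformalChristoffel g.ofLp i k j := by
  have hpderiv : ∀ a b c, pderiv c (fun z => conformalMetric φ z a b) x =
      2 * Real.exp (2 * φ x) * ((1 : Matrix (Fin n) (Fin n) ℝ) a b * g c) := fun a b c => by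
    have hexp : HasFDerivAt (fun z => conformalMetric φ z a b) _ x :=
      ((h.hasFDerivAt.const_mul 2).exp).mul_const ((1 : Matrix (Fin n) (Fin n) ℝ) a b)
    rw [← pderiv_eq_of_hasGradientAt h, pderiv, pderiv, hexp.fderiv, h.hasFDerivAt.fderiv]
    simp only [smul_apply, smul_eq_mul]
    ring
  simp only [christoffel, hpderiv]
  rw [conformalMetric, smul_one_inv (Real.exp_ne_zero _), Finset.sum_eq_single k
    (fun l _ hl => by simp [Matrix.one_apply_ne' hl]) (by simp), conformalChristoffel_apply,
    Matrix.isSymm_one.apply k j, Matrix.isSymm_one.apply k i, Matrix.smul_apply,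
    Matrix.one_apply_eq, smul_eq_mul]
  field_simp

theorem covDeriv_conformalMetric {g : E n} (h : HasGradientAt φ g x) (Y : E n → E n) (v : E n) :
    covDeriv (conformalMetric φ) Y x v =
      fderiv ℝ Y x v + ⟪g, v⟫_ℝ • Y x + ⟪g, Y x⟫_ℝ • v - ⟪v, Y x⟫_ℝ • g := by
  ext k
  have hsum : ∀ i, ∑ j, christoffel (conformalMetric φ) k i j x * v i * Y x j =
      v i * (conformalChristoffel g.ofLp i *ᵥ (Y x).ofLp) k := fun i => by
    simp only [christoffel_conformalMetric h, Matrix.mulVec, dotProduct, Finset.mul_sum]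
    exact Finset.sum_congr rfl fun j _ => by ring
  simp only [covDeriv, hsum, conformalChristoffel_mulVec]
  have hrow : ∀ i, v i * (g i * Y x k + (1 : Matrix (Fin n) (Fin n) ℝ) k i * (g.ofLp ⬝ᵥ Y x) -
      g k * Y x i) = v i * g i * Y x k +
        (1 : Matrix (Fin n) (Fin n) ℝ) k i * v i * (g.ofLp ⬝ᵥ Y x) - Y x i * v i * g k :=
    fun i => by ring
  have hdiag : ∑ i, (1 : Matrix (Fin n) (Fin n) ℝ) k i * v i = v k := by
    simp [Matrix.one_apply]
  simp only [hrow, Finset.sum_sub_distrib, Finset.sum_add_distrib, ← Finset.sum_mul, hdiag]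
  simp only [PiLp.add_apply, PiLp.sub_apply, PiLp.smul_apply, smul_eq_mul, PiLp.inner_apply,
    RCLike.inner_apply, conj_trivial, dotProduct]
  simp only [mul_comm]
  ring

theorem pderiv_christoffel_conformalMetric {g : E n → E n} {H : E n →L[ℝ] E n}
    (hφ : ∀ᶠ z in 𝓝 x, HasGradientAt φ (g z) z) (hg : HasFDerivAt g H x) (k i j l : Fin n) :
    pderiv l (christoffel (conformalMetric φ) k i j) x =
      conformalChristoffel (H (basisVec l)).ofLp i k j := by
  have hcoord : ∀ c, HasFDerivAt (fun z => g z c) ((EuclideanSpace.proj c : E n →L[ℝ] ℝ) ∘L H) x :=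
    fun c => (EuclideanSpace.proj c : E n →L[ℝ] ℝ).hasFDerivAt.comp x hg
  have heq : christoffel (conformalMetric φ) k i j =ᶠ[𝓝 x] fun z =>
      (1 : Matrix (Fin n) (Fin n) ℝ) k j * g z i + (1 : Matrix (Fin n) (Fin n) ℝ) k i * g z j -
        (1 : Matrix (Fin n) (Fin n) ℝ) i j * g z k :=
    hφ.mono fun z hz => by rw [christoffel_conformalMetric hz, conformalChristoffel_apply]
  have hderiv := ((((hcoord i).const_mul ((1 : Matrix (Fin n) (Fin n) ℝ) k j)).fun_add
    ((hcoord j).const_mul ((1 : Matrix (Fin n) (Fin n) ℝ) k i))).fun_sub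
    ((hcoord k).const_mul ((1 : Matrix (Fin n) (Fin n) ℝ) i j))).congr_of_eventuallyEq heq
  rw [pderiv, hderiv.fderiv, conformalChristoffel_apply]
  rfl

theorem inner_hessian_comm {F : Type*} [NormedAddCommGroup F] [InnerProductSpace ℝ F]
    [CompleteSpace F] {φ : F → ℝ} {g : F → F} {H : F →L[ℝ] F} {x : F}
    (hφ : ∀ᶠ z in 𝓝 x, HasGradientAt φ (g z) z) (hg : HasFDerivAt g H x) (v w : F) :
    ⟪H v, w⟫_ℝ = ⟪v, H w⟫_ℝ :=
  (second_derivative_symmetric_of_eventually (hφ.mono fun _ hz => hz.hasFDerivAt)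
    ((InnerProductSpace.toDual ℝ F).toContinuousLinearEquiv.toContinuousLinearMap.hasFDerivAt.comp
      x hg) v w).trans (real_inner_comm _ _)

theorem trace_eq_sum_apply_basisVec (H : E n →ₗ[ℝ] E n) :
    LinearMap.trace ℝ (E n) H = ∑ i, H (basisVec i) i := by
  rw [H.trace_eq_sum_inner (EuclideanSpace.basisFun (Fin n) ℝ)]
  simp [basisVec, EuclideanSpace.inner_single_left]

theorem ricciComp_conformalMetric {g : E n → E n} {H : E n →L[ℝ] E n}
    (hφ : ∀ᶠ z in 𝓝 x, HasGradientAt φ (g z) z) (hg : HasFDerivAt g H x) (i j : Fin n) :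
    ricciComp (conformalMetric φ) i j x =
      -(n - 2) * (H (basisVec j) i - g x i * g x j) -
        (1 : Matrix (Fin n) (Fin n) ℝ) i j *
          (LinearMap.trace ℝ (E n) H + (n - 2) * ‖g x‖ ^ 2) := by
  set f : Fin n → ℝ := (g x).ofLp
  have hdiv : ∑ k, conformalChristoffel (H (basisVec k)).ofLp i k j =
      H (basisVec j) i + H (basisVec i) j -
        (1 : Matrix (Fin n) (Fin n) ℝ) i j * LinearMap.trace ℝ (E n) H := by
    simp only [conformalChristoffel_apply, Finset.sum_sub_distrib, Finset.sum_add_distrib,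
      ← Finset.mul_sum, trace_eq_sum_apply_basisVec]
    congr 1
    simp [Matrix.one_apply]
  have hdtrace : ∑ k, conformalChristoffel (H (basisVec j)).ofLp i k k = n * H (basisVec j) i :=
    trace_conformalChristoffel _ i
  have htrace : ∑ k, ∑ l, conformalChristoffel f k k l * conformalChristoffel f i l j =
      n * (2 * (f i * f j) - (1 : Matrix (Fin n) (Fin n) ℝ) i j * (f ⬝ᵥ f)) := by
    rw [Finset.sum_comm, ← dotProduct_conformalChristoffel, Finset.mul_sum]
    refine Finset.sum_congr rfl fun l _ => ?_
    simp only [conformalChristoffel_comm f _ l, ← Finset.sum_mul]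
    rw [← mul_assoc, ← trace_conformalChristoffel]
    rfl
  have hsq : ∑ k, ∑ l, conformalChristoffel f j k l * conformalChristoffel f i l k =
      (n + 2) * (f j * f i) - 2 * ((1 : Matrix (Fin n) (Fin n) ℝ) j i * (f ⬝ᵥ f)) :=
    trace_conformalChristoffel_mul f j i
  have hnorm : f ⬝ᵥ f = ‖g x‖ ^ 2 := by
    rw [← real_inner_self_eq_norm_sq, EuclideanSpace.inner_eq_star_dotProduct, star_trivial]
  have hsymm : H (basisVec i) j = H (basisVec j) i := by
    simpa [basisVec, EuclideanSpace.inner_single_left, EuclideanSpace.inner_single_right] using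
      inner_hessian_comm hφ hg (basisVec i) (basisVec j)
  simp only [ricciComp, pderiv_christoffel_conformalMetric hφ hg,
    christoffel_conformalMetric hφ.self_of_nhds, Finset.sum_add_distrib, Finset.sum_sub_distrib]
  rw [hdiv, hdtrace, htrace, hsq, hnorm, hsymm, Matrix.isSymm_one.apply i j]
  ring

theorem ricci_conformalMetric {g : E n → E n} {H : E n →L[ℝ] E n}
    (hφ : ∀ᶠ z in 𝓝 x, HasGradientAt φ (g z) z) (hg : HasFDerivAt g H x) (v w : E n) :
    ricci (conformalMetric φ) x v w =
      -(n - 2) * (⟪v, H w⟫_ℝ - ⟪g x, v⟫_ℝ * ⟪g x, w⟫_ℝ) -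
        (LinearMap.trace ℝ (E n) H + (n - 2) * ‖g x‖ ^ 2) * ⟪v, w⟫_ℝ := by
  simp only [ricci, ricciComp_conformalMetric hφ hg]
  set T := LinearMap.trace ℝ (E n) H + (n - 2) * ‖g x‖ ^ 2
  have hHw : ∀ i, H w i = ∑ j, w j * H (basisVec j) i := fun i => by
    conv_lhs => rw [← (EuclideanSpace.basisFun (Fin n) ℝ).sum_repr w]
    simp [basisVec]
  have hrow : ∀ i, ∑ j, (-((n : ℝ) - 2) * (H (basisVec j) i - g x i * g x j) -
      (1 : Matrix (Fin n) (Fin n) ℝ) i j * T) * v i * w j =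
      -(n - 2) * (v i * H w i - v i * g x i * ∑ j, w j * g x j) - T * (v i * w i) := fun i => by
    have hdiag : ∑ j, (1 : Matrix (Fin n) (Fin n) ℝ) i j * w j = w i := by
      simp [Matrix.one_apply]
    rw [hHw, ← hdiag]
    simp only [Finset.mul_sum, ← Finset.sum_sub_distrib]
    exact Finset.sum_congr rfl fun j _ => by ring
  simp only [hrow, Finset.sum_sub_distrib, ← Finset.mul_sum, ← Finset.sum_mul]
  simp only [PiLp.inner_apply, RCLike.inner_apply, conj_trivial]
  simp only [mul_comm]

theorem hasFDerivAt_gradient_comp_norm {F : Type*} [NormedAddCommGroup F] [InnerProductSpace ℝ F]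
    [CompleteSpace F] {φ' : ℝ → ℝ} {φ'' : ℝ} {x : F} (hx : x ≠ 0)
    (hφ' : HasDerivAt φ' φ'' ‖x‖) :
    HasFDerivAt (fun z : F => (φ' ‖z‖ / ‖z‖) • z)
      ((φ' ‖x‖ / ‖x‖) • ContinuousLinearMap.id ℝ F +
        ((φ'' - φ' ‖x‖ / ‖x‖) / ‖x‖ ^ 2) • InnerProductSpace.rankOne ℝ x x) x := by
  have hr : ‖x‖ ≠ 0 := norm_ne_zero_iff.2 hx
  have hslope := (hasGradientAt_comp_norm hx
    (hφ'.fun_div (hasDerivAt_id' ‖x‖) hr)).hasFDerivAt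
  refine (hslope.fun_smul (hasFDerivAt_id x)).congr_fderiv ?_
  ext1 w
  have hcoeff : (φ'' * ‖x‖ - φ' ‖x‖) / ‖x‖ ^ 2 / ‖x‖ = (φ'' - φ' ‖x‖ / ‖x‖) / ‖x‖ ^ 2 := by
    field_simp
  simp [hcoeff, mul_smul]

theorem ricci_conformalMetric_comp_norm {φ φ' : ℝ → ℝ} {φ'' : ℝ} (hx : x ≠ 0)
    (hφ : ∀ᶠ r in 𝓝 ‖x‖, HasDerivAt φ (φ' r) r) (hφ' : HasDerivAt φ' φ'' ‖x‖) {v : E n}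
    (hv : ⟪x, v⟫_ℝ = 0) :
    ricci (conformalMetric fun z => φ ‖z‖) x v v =
      -(φ'' + (2 * n - 3) * (φ' ‖x‖ / ‖x‖) + (n - 2) * φ' ‖x‖ ^ 2) * ‖v‖ ^ 2 := by
  have hr : ‖x‖ ≠ 0 := norm_ne_zero_iff.2 hx
  have hgrad : ∀ᶠ z in 𝓝 x, HasGradientAt (fun z : E n => φ ‖z‖) ((φ' ‖z‖ / ‖z‖) • z) z :=
    ((continuous_norm.tendsto x).eventually hφ).and (isOpen_ne.eventually_mem hx) |>.mono
      fun z hz => hasGradientAt_comp_norm hz.2 hz.1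
  rw [ricci_conformalMetric hgrad (hasFDerivAt_gradient_comp_norm hx hφ')]
  set H := (φ' ‖x‖ / ‖x‖) • ContinuousLinearMap.id ℝ (E n) +
    ((φ'' - φ' ‖x‖ / ‖x‖) / ‖x‖ ^ 2) • InnerProductSpace.rankOne ℝ x x with hH
  have hHv : H v = (φ' ‖x‖ / ‖x‖) • v := by simp [hH, hv]
  have htrace : LinearMap.trace ℝ (E n) H = n * (φ' ‖x‖ / ‖x‖) + (φ'' - φ' ‖x‖ / ‖x‖) := by
    simp only [hH, ContinuousLinearMap.toLinearMap_add, ContinuousLinearMap.toLinearMap_smul,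
      ContinuousLinearMap.coe_id, map_add, map_smul, LinearMap.trace_id, finrank_euclideanSpace,
      Fintype.card_fin, smul_eq_mul, InnerProductSpace.trace_rankOne, real_inner_self_eq_norm_sq]
    field_simp
  have hnorm : ‖(φ' ‖x‖ / ‖x‖) • x‖ ^ 2 = φ' ‖x‖ ^ 2 := by
    rw [norm_smul, mul_pow, Real.norm_eq_abs, sq_abs, div_pow, div_mul_cancel₀ _ (pow_ne_zero 2 hr)]
  rw [hHv, htrace, hnorm, real_inner_smul_left, hv, real_inner_smul_right,
    real_inner_self_eq_norm_sq]
  ring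

end ConformallyFlat

section ConformallyFlatHypersurfaces

open scoped InnerProductSpace

theorem sum_smul_one_apply_mul_mul {n : ℕ} (c : ℝ) (v w : E n) :
    ∑ i, ∑ j, (c • (1 : Matrix (Fin n) (Fin n) ℝ)) i j * v i * w j = c * ⟪v, w⟫_ℝ := by
  simp only [Matrix.smul_apply, Matrix.one_apply, smul_eq_mul, mul_ite, mul_one, mul_zero,
    ite_mul, zero_mul, Finset.sum_ite_eq, Finset.mem_univ, if_true, PiLp.inner_apply,
    RCLike.inner_apply, conj_trivial, Finset.mul_sum]
  exact Finset.sum_congr rfl fun i _ => by ring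

theorem metricForm_conformalMetric {n : ℕ} (φ : E n → ℝ) (x v w : E n) :
    metricForm (conformalMetric φ) x v w = Real.exp (2 * φ x) * ⟪v, w⟫_ℝ :=
  sum_smul_one_apply_mul_mul _ v w

theorem secondFundamentalForm_conformalMetric {n : ℕ} {φ : E n → ℝ} {x g : E n}
    (h : HasGradientAt φ g x) {Z : E n → E n} (hZ : DifferentiableAt ℝ Z x) {v : E n}
    (hv : ⟪v, Z x⟫_ℝ = 0) (w : E n) :
    secondFundamentalForm (conformalMetric φ) (fun z => Real.exp (-φ z) • Z z) x v w =
      -(Real.exp (φ x) * (⟪fderiv ℝ Z x v, w⟫_ℝ + ⟪g, Z x⟫_ℝ * ⟪v, w⟫_ℝ)) := by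
  have hderiv : fderiv ℝ (fun z => Real.exp (-φ z) • Z z) x v =
      Real.exp (-φ x) • (fderiv ℝ Z x v - ⟪g, v⟫_ℝ • Z x) := by
    rw [((h.hasFDerivAt.fun_neg.exp).fun_smul hZ.hasFDerivAt).fderiv]
    simp [smul_smul, sub_eq_add_neg]
  have hcov : covDeriv (conformalMetric φ) (fun z => Real.exp (-φ z) • Z z) x v =
      Real.exp (-φ x) • (fderiv ℝ Z x v + ⟪g, Z x⟫_ℝ • v) := by
    rw [covDeriv_conformalMetric h, hderiv, real_inner_smul_right, real_inner_smul_right, hv]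
    module
  have hexp : Real.exp (2 * φ x) * Real.exp (-φ x) = Real.exp (φ x) := by
    rw [← Real.exp_add]
    ring_nf
  rw [secondFundamentalForm, metricForm_conformalMetric, hcov, real_inner_smul_left,
    inner_add_left, real_inner_smul_left, ← mul_assoc, hexp]

theorem secondFundamentalForm_conformalMetric_sphere {n : ℕ} {φ : ℝ → ℝ} {φ' : ℝ} {x : E n}
    (hx : x ≠ 0) (hφ : HasDerivAt φ φ' ‖x‖) {v : E n} (hv : ⟪x, v⟫_ℝ = 0) (w : E n) :
    secondFundamentalForm (conformalMetric fun z => φ ‖z‖)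
        (fun z => Real.exp (-φ ‖z‖) • (1 / ‖z‖) • z) x v w =
      -(Real.exp (φ ‖x‖) * ((1 / ‖x‖ + φ') * ⟪v, w⟫_ℝ)) := by
  have hr : ‖x‖ ≠ 0 := norm_ne_zero_iff.2 hx
  have hZ := hasFDerivAt_gradient_comp_norm hx (hasDerivAt_const ‖x‖ (1 : ℝ))
  rw [secondFundamentalForm_conformalMetric (hasGradientAt_comp_norm hx hφ) hZ.differentiableAt
    (by rw [real_inner_smul_right, real_inner_comm, hv, mul_zero]), hZ.fderiv]
  simp only [add_apply, smul_apply, ContinuousLinearMap.id_apply, InnerProductSpace.rankOne_apply,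
    hv, zero_smul, smul_zero, add_zero, real_inner_smul_left, real_inner_smul_right,
    real_inner_self_eq_norm_sq]
  field_simp

variable {d : ℕ} {ψ : E d → ℝ}

theorem coordTangent_linearIsometry {n : ℕ} (L : E d →ₗᵢ[ℝ] E n) (i : Fin d) (y : E d) :
    coordTangent L i y = L (basisVec i) :=
  congrArg (fun T : E d →L[ℝ] E n => T (basisVec i)) L.toContinuousLinearMap.fderiv

theorem inducedMetric_conformalMetric_linearIsometry {n : ℕ} (φ : E n → ℝ)
    (L : E d →ₗᵢ[ℝ] E n) :
    inducedMetric (conformalMetric φ) L = conformalMetric fun y => φ (L y) := by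
  funext y
  ext i j
  rw [inducedMetric, Matrix.of_apply, metricForm_conformalMetric, coordTangent_linearIsometry,
    coordTangent_linearIsometry, L.inner_map_map, basisVec, basisVec,
    EuclideanSpace.inner_single_left, conformalMetric, Matrix.smul_apply, Matrix.one_apply]
  simp

theorem normSqSecondFundamentalForm_linearIsometry {n : ℕ} {φ : E n → ℝ} {L : E d →ₗᵢ[ℝ] E n}
    {N g : E n} (hN : ∀ v, ⟪L v, N⟫_ℝ = 0) {y : E d} (h : HasGradientAt φ g (L y))
    (hg : ⟪g, N⟫_ℝ = 0) :
    normSqSecondFundamentalForm (conformalMetric φ) L (fun z => Real.exp (-φ z) • N) y = 0 := by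
  have hA : ∀ v w, secondFundamentalForm (conformalMetric φ) (fun z => Real.exp (-φ z) • N)
      (L y) (L v) w = 0 := fun v w => by
    rw [secondFundamentalForm_conformalMetric h (differentiableAt_const N) (hN v), hg]
    simp
  simp [normSqSecondFundamentalForm, coordTangent_linearIsometry, hA]

theorem conformalMetric_inv (y : E d) :
    (conformalMetric ψ y)⁻¹ = Real.exp (-(2 * ψ y)) • 1 := by
  rw [conformalMetric, smul_one_inv (Real.exp_ne_zero _), Real.exp_neg]

theorem volDensity_conformalMetric (y : E d) :
    volDensity (conformalMetric ψ) y = Real.exp (d * ψ y) := by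
  rw [volDensity, conformalMetric, Matrix.det_smul, Matrix.det_one, Fintype.card_fin,
    mul_one, ← Real.exp_nat_mul, Real.sqrt_eq_rpow, ← Real.exp_mul]
  ring_nf

theorem laplaceBeltrami_conformalMetric_mul_volDensity (S : Set (E d)) (w : E d → ℝ) (y : E d) :
    laplaceBeltrami (conformalMetric ψ) S w y * volDensity (conformalMetric ψ) y =
      divergenceOn S (fun z => Real.exp ((d - 2) * ψ z) • gradientWithin w S z) y := by
  have hflux : ∀ i, (fun z => volDensity (conformalMetric ψ) z *
      ∑ j, (conformalMetric ψ z)⁻¹ i j * pderivOn S j w z) =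
      fun z => (Real.exp ((d - 2) * ψ z) • gradientWithin w S z) i := fun i => by
    funext z
    have hexp : Real.exp (d * ψ z) * Real.exp (-(2 * ψ z)) = Real.exp ((d - 2) * ψ z) := by
      rw [← Real.exp_add]
      ring_nf
    simp [conformalMetric_inv, volDensity_conformalMetric, Matrix.one_apply,
      gradientWithin_apply, ← hexp, mul_assoc]
  have hvol : volDensity (conformalMetric ψ) y ≠ 0 := by
    rw [volDensity_conformalMetric]
    exact Real.exp_ne_zero _
  simp only [laplaceBeltrami, hflux, divergenceOn]
  rw [mul_comm, mul_inv_cancel_left₀ hvol]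

end ConformallyFlatHypersurfaces

section SchwarzschildProfile

open scoped InnerProductSpace

variable {k : ℕ} {m r : ℝ}

/-- The function `φ` with `g_Sch = e^{2φ(|x|)} δ` on `ℝ^{k+2}`. -/
def conformalExponent (k : ℕ) (m r : ℝ) : ℝ := 2 / k * Real.log (1 + m / (2 * r ^ k))

/-- The derivative `φ'` of the conformal exponent. -/
def conformalSlope (k : ℕ) (m r : ℝ) : ℝ := -m / (r * (r ^ k + m / 2))

theorem conformalFactor_eq_exp (hm : 0 < m) (x : E (k + 2)) :
    conformalFactor (k + 2) m x = Real.exp (2 * conformalExponent k m ‖x‖) := by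
  have hpos : 0 < 1 + m / (2 * ‖x‖ ^ k) := by positivity
  rw [conformalFactor, conformalExponent, Nat.add_sub_cancel, Real.rpow_def_of_pos hpos]
  push_cast
  ring_nf

theorem sqrt_conformalFactor (hm : 0 < m) (x : E (k + 2)) :
    √(conformalFactor (k + 2) m x) = Real.exp (conformalExponent k m ‖x‖) := by
  rw [conformalFactor_eq_exp hm, two_mul, Real.exp_add, Real.sqrt_mul_self (Real.exp_nonneg _)]

theorem schwarzschildMetric_eq_conformalMetric (hm : 0 < m) :
    schwarzschildMetric (k + 2) m = conformalMetric fun x => conformalExponent k m ‖x‖ := by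
  funext x
  rw [schwarzschildMetric, conformalFactor_eq_exp hm, conformalMetric]

theorem hasDerivAt_conformalExponent (hk : k ≠ 0) (hm : 0 < m) (hr : 0 < r) :
    HasDerivAt (conformalExponent k m) (conformalSlope k m r) r := by
  have hpos : 0 < 1 + m / (2 * r ^ k) := by positivity
  have hbase := ((hasDerivAt_const r m).fun_div ((hasDerivAt_pow k r).const_mul 2)
    (by positivity)).const_add 1
  refine ((hbase.log hpos.ne').const_mul (2 / (k : ℝ))).congr_deriv ?_
  obtain ⟨l, rfl⟩ := Nat.exists_eq_succ_of_ne_zero hk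
  rw [conformalSlope, Nat.succ_eq_add_one, Nat.add_sub_cancel]
  field_simp
  ring

/-- The equation for `φ''` says that `g_Sch` is scalar flat. -/
theorem hasDerivAt_conformalSlope (hm : 0 < m) (hr : 0 < r) :
    HasDerivAt (conformalSlope k m)
      (-(k + 1) * conformalSlope k m r / r - k / 2 * conformalSlope k m r ^ 2) r := by
  have hpow : HasDerivAt (fun s : ℝ => s ^ k) (k * r ^ k / r) r := by
    refine (hasDerivAt_pow k r).congr_deriv ?_
    rcases k with _ | l
    · simp
    · rw [Nat.add_sub_cancel, pow_succ, mul_div_assoc, mul_div_cancel_right₀ _ hr.ne']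
  refine ((hasDerivAt_const r (-m)).fun_div ((hasDerivAt_id' r).fun_mul (hpow.add_const (m / 2)))
    (by positivity)).congr_deriv ?_
  rw [conformalSlope]
  field_simp
  ring

theorem contDiffAt_conformalExponent (hm : 0 < m) {l : WithTop ℕ∞} (hr : 0 < r) :
    ContDiffAt ℝ l (conformalExponent k m) r := by
  have hbase : ContDiffAt ℝ l (fun s : ℝ => 1 + m / (2 * s ^ k)) r :=
    contDiffAt_const.add (contDiffAt_const.div (contDiffAt_const.mul (contDiffAt_id.pow k))
      (by positivity))
  exact contDiffAt_const.mul (hbase.log (by positivity))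

theorem contDiffAt_conformalSlope (hm : 0 < m) {l : WithTop ℕ∞} (hr : 0 < r) :
    ContDiffAt ℝ l (conformalSlope k m) r :=
  contDiffAt_const.div (contDiffAt_id.mul ((contDiffAt_id.pow k).add contDiffAt_const))
    (by positivity)

theorem horizonRadius_pos (n : ℕ) (hm : 0 < m) : 0 < horizonRadius n m := by
  unfold horizonRadius
  positivity

theorem horizonRadius_pow (hk : k ≠ 0) (hm : 0 < m) : horizonRadius (k + 2) m ^ k = m / 2 := by
  rw [horizonRadius, Nat.cast_add, Nat.cast_ofNat, add_sub_cancel_right, one_div,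
    Real.rpow_inv_natCast_pow (by positivity) hk]

/-- The area radius `r e^{φ(r)}` is critical at the horizon. -/
theorem inv_add_conformalSlope_horizonRadius (hk : k ≠ 0) (hm : 0 < m) :
    1 / horizonRadius (k + 2) m + conformalSlope k m (horizonRadius (k + 2) m) = 0 := by
  have hpos := horizonRadius_pos (k + 2) hm
  rw [conformalSlope, horizonRadius_pow hk hm]
  field_simp
  ring

/-- The function `e^{2φ} Ric(ξ, ξ)` of `r = |x|`, for a unit vector `ξ` tangent to the spheres. -/
def jacobiPotential (k : ℕ) (m r : ℝ) : ℝ :=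
  -(k * conformalSlope k m r * (1 / r + conformalSlope k m r / 2))

theorem ricci_schwarzschildMetric (hk : k ≠ 0) (hm : 0 < m) {x v : E (k + 2)} (hx : x ≠ 0)
    (hv : ⟪x, v⟫_ℝ = 0) :
    ricci (schwarzschildMetric (k + 2) m) x v v = jacobiPotential k m ‖x‖ * ‖v‖ ^ 2 := by
  have hr : 0 < ‖x‖ := norm_pos_iff.2 hx
  rw [schwarzschildMetric_eq_conformalMetric hm, ricci_conformalMetric_comp_norm hx
    ((eventually_gt_nhds hr).mono fun s hs => hasDerivAt_conformalExponent hk hm hs)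
    (hasDerivAt_conformalSlope hm hr) hv, jacobiPotential]
  push_cast
  ring

theorem secondFundamentalForm_horizonNormal (hk : k ≠ 0) (hm : 0 < m) {x v : E (k + 2)}
    (hx : ‖x‖ = horizonRadius (k + 2) m) (hv : ⟪x, v⟫_ℝ = 0) (w : E (k + 2)) :
    secondFundamentalForm (schwarzschildMetric (k + 2) m) (horizonNormal (k + 2) m) x v w = 0 := by
  have hr : 0 < ‖x‖ := hx ▸ horizonRadius_pos (k + 2) hm
  have hη : horizonNormal (k + 2) m =
      fun z => Real.exp (-conformalExponent k m ‖z‖) • (1 / ‖z‖) • z := funext fun z => by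
    rw [horizonNormal, sqrt_conformalFactor hm, mul_inv, mul_smul, Real.exp_neg, one_div]
  rw [schwarzschildMetric_eq_conformalMetric hm, hη, secondFundamentalForm_conformalMetric_sphere
    (norm_pos_iff.1 hr) (hasDerivAt_conformalExponent hk hm hr) hv, hx,
    inv_add_conformalSlope_horizonRadius hk hm, zero_mul, mul_zero, neg_zero]

/-- The weight `√(det h) h^{ii} = e^{(k-1)φ}` of the Dirichlet integral of the metric
`h = e^{2φ} δ` on `ℝ^{k+1}`, as a function of `r = |y|`. -/
def dirichletWeight (k : ℕ) (m r : ℝ) : ℝ := Real.exp ((k - 1) * conformalExponent k m r)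

/-- The function `κ` with `-∇w / w = κ(|y|) y` for the reciprocal area radius
`w = 1 / (r e^{φ(r)})`. -/
def barrierSlope (k : ℕ) (m r : ℝ) : ℝ := (1 / r + conformalSlope k m r) / r

theorem hasDerivAt_dirichletWeight_mul_barrierSlope (hk : k ≠ 0) (hm : 0 < m) (hr : 0 < r) :
    HasDerivAt (fun s => dirichletWeight k m s * barrierSlope k m s)
      (dirichletWeight k m r * (jacobiPotential k m r +
        (k - 1) * (r * barrierSlope k m r) ^ 2 - (k + 1) * barrierSlope k m r) / r) r := by
  have hweight := ((hasDerivAt_conformalExponent hk hm hr).const_mul ((k : ℝ) - 1)).exp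
  have hslope := ((hasDerivAt_id' r).fun_inv hr.ne').fun_add
    (hasDerivAt_conformalSlope (k := k) hm hr)
  simp only [dirichletWeight, barrierSlope, one_div]
  refine (hweight.fun_mul (hslope.fun_div (hasDerivAt_id' r) hr.ne')).congr_deriv ?_
  rw [jacobiPotential]
  field_simp
  ring

theorem contDiffAt_dirichletWeight (hm : 0 < m) {l : WithTop ℕ∞} (hr : 0 < r) :
    ContDiffAt ℝ l (dirichletWeight k m) r :=
  (contDiffAt_const.mul (contDiffAt_conformalExponent hm hr)).exp

theorem contDiffAt_barrierSlope (hm : 0 < m) {l : WithTop ℕ∞} (hr : 0 < r) :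
    ContDiffAt ℝ l (barrierSlope k m) r :=
  ((contDiffAt_const.div contDiffAt_id hr.ne').add (contDiffAt_conformalSlope hm hr)).div
    contDiffAt_id hr.ne'

theorem contDiffAt_jacobiPotential (hm : 0 < m) {l : WithTop ℕ∞} (hr : 0 < r) :
    ContDiffAt ℝ l (jacobiPotential k m) r :=
  ((contDiffAt_const.mul (contDiffAt_conformalSlope hm hr)).mul
    ((contDiffAt_const.div contDiffAt_id hr.ne').add
      ((contDiffAt_conformalSlope hm hr).div_const 2))).neg

theorem divergenceOn_barrier (hk : k ≠ 0) (hm : 0 < m) {a b : ℝ} (ha : 0 < a) (hab : a < b)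
    {y : E (k + 1)} (hy : y ∈ shell a b) :
    divergenceOn (shell a b) (fun z => dirichletWeight k m ‖z‖ • barrierSlope k m ‖z‖ • z) y =
      dirichletWeight k m ‖y‖ *
        (jacobiPotential k m ‖y‖ + (k - 1) * ‖barrierSlope k m ‖y‖ • y‖ ^ 2) := by
  have hr : 0 < ‖y‖ := ha.trans_le hy.1
  simp only [smul_smul]
  rw [divergenceOn_comp_norm_smul_shell ha hab hy
    (hasDerivAt_dirichletWeight_mul_barrierSlope hk hm hr), norm_smul, mul_pow,
    mul_pow, Real.norm_eq_abs, sq_abs]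
  push_cast
  field_simp
  ring

end SchwarzschildProfile

section Hypersurface

open scoped InnerProductSpace

/-- The chart of `ρ(Σ₀)` as a linear isometric embedding of `ℝ^d`. -/
def chartIsometry (d : ℕ) (ρ : E (d + 1) ≃ₗᵢ[ℝ] E (d + 1)) : E d →ₗᵢ[ℝ] E (d + 1) where
  toFun := chart d ρ
  map_add' y z := by
    rw [chart, chart, chart, ← map_add]
    congr 1
    ext i
    refine Fin.lastCases ?_ (fun i => ?_) i <;> simp
  map_smul' c y := by
    rw [chart, chart, RingHom.id_apply, ← map_smul]
    congr 1
    ext i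
    refine Fin.lastCases ?_ (fun i => ?_) i <;> simp
  norm_map' := norm_chart d ρ

theorem inner_chart_basisVec_last (d : ℕ) (ρ : E (d + 1) ≃ₗᵢ[ℝ] E (d + 1)) (y : E d) :
    ⟪chart d ρ y, ρ (basisVec (Fin.last d))⟫_ℝ = 0 := by
  rw [chart, LinearIsometryEquiv.inner_map_map, basisVec, EuclideanSpace.inner_single_right]
  simp

theorem inner_chart_normalField (d : ℕ) (m : ℝ) (ρ : E (d + 1) ≃ₗᵢ[ℝ] E (d + 1)) (y : E d)
    (x : E (d + 1)) : ⟪chart d ρ y, normalField d m ρ x⟫_ℝ = 0 := by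
  rw [normalField, real_inner_smul_right, inner_chart_basisVec_last, mul_zero]

theorem inChart_eq_zero_of_norm_eq {d : ℕ} {m R : ℝ} {ρ : E (d + 1) ≃ₗᵢ[ℝ] E (d + 1)}
    {u : SigmaR d m ρ R → ℝ} (hu : ∀ x : SigmaR d m ρ R, ‖(x : E (d + 1))‖ = R → u x = 0)
    {y : E d} (hy : ‖y‖ = R) : inChart u y = 0 := by
  rw [inChart]
  split_ifs
  · exact hu _ (by rw [norm_chart, hy])
  · rfl

variable {k : ℕ} {m : ℝ} {ρ : E (k + 2) ≃ₗᵢ[ℝ] E (k + 2)} {y : E (k + 1)}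

theorem chart_ne_zero (hy : y ≠ 0) : chart (k + 1) ρ y ≠ 0 :=
  (map_ne_zero_iff (chartIsometry (k + 1) ρ) (chartIsometry (k + 1) ρ).injective).2 hy

theorem normalField_eq_exp_smul (hm : 0 < m) :
    normalField (k + 1) m ρ = fun x => Real.exp (-conformalExponent k m ‖x‖) •
      ρ (basisVec (Fin.last (k + 1))) := funext fun x => by
  rw [normalField, sqrt_conformalFactor hm, Real.exp_neg]

theorem sigmaMetric_eq_conformalMetric (hm : 0 < m) :
    sigmaMetric (k + 1) m ρ = conformalMetric fun y => conformalExponent k m ‖y‖ := by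
  rw [sigmaMetric, schwarzschildMetric_eq_conformalMetric hm]
  refine (inducedMetric_conformalMetric_linearIsometry _ (chartIsometry (k + 1) ρ)).trans ?_
  simp only [LinearIsometry.norm_map]

theorem normSqSecondFundamentalForm_chart (hk : k ≠ 0) (hm : 0 < m) (hy : y ≠ 0) :
    normSqSecondFundamentalForm (schwarzschildMetric (k + 2) m) (chart (k + 1) ρ)
      (normalField (k + 1) m ρ) y = 0 := by
  have hx := chart_ne_zero (ρ := ρ) hy
  rw [schwarzschildMetric_eq_conformalMetric hm, normalField_eq_exp_smul hm]
  exact normSqSecondFundamentalForm_linearIsometry (L := chartIsometry (k + 1) ρ)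
    (inner_chart_basisVec_last (k + 1) ρ)
    (hasGradientAt_comp_norm hx (hasDerivAt_conformalExponent hk hm (norm_pos_iff.2 hx)))
    ((real_inner_smul_left ..).trans
      (mul_eq_zero_of_right _ (inner_chart_basisVec_last (k + 1) ρ y)))

theorem ricci_normalField_mul_volDensity (hk : k ≠ 0) (hm : 0 < m) (hy : y ≠ 0) :
    ricci (schwarzschildMetric (k + 2) m) (chart (k + 1) ρ y)
        (normalField (k + 1) m ρ (chart (k + 1) ρ y))
        (normalField (k + 1) m ρ (chart (k + 1) ρ y)) * volDensity (sigmaMetric (k + 1) m ρ) y =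
      dirichletWeight k m ‖y‖ * jacobiPotential k m ‖y‖ := by
  have hnorm : ‖normalField (k + 1) m ρ (chart (k + 1) ρ y)‖ ^ 2 =
      Real.exp (-(2 * conformalExponent k m ‖y‖)) := by
    rw [normalField_eq_exp_smul hm, norm_smul, LinearIsometryEquiv.norm_map, basisVec,
      PiLp.norm_single, norm_one, mul_one, Real.norm_eq_abs, Real.abs_exp, norm_chart,
      ← Real.exp_nat_mul]
    push_cast
    ring_nf
  rw [ricci_schwarzschildMetric hk hm (chart_ne_zero hy) (inner_chart_normalField _ _ _ _ _),
    hnorm, norm_chart, sigmaMetric_eq_conformalMetric hm, volDensity_conformalMetric, mul_assoc,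
    ← Real.exp_add, mul_comm, dirichletWeight]
  push_cast
  ring_nf

theorem jacobiOperator_mul_volDensity (hk : k ≠ 0) (hm : 0 < m) (R : ℝ) (w : E (k + 1) → ℝ)
    (hy : y ≠ 0) :
    jacobiOperator (k + 1) m ρ R w y * volDensity (sigmaMetric (k + 1) m ρ) y =
      divergenceOn (annulus (k + 1) m R)
          (fun z => dirichletWeight k m ‖z‖ • gradientWithin w (annulus (k + 1) m R) z) y +
        dirichletWeight k m ‖y‖ * jacobiPotential k m ‖y‖ * w y := by
  rw [jacobiOperator, normSqSecondFundamentalForm_chart hk hm hy, add_zero, add_mul, mul_right_comm,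
    ricci_normalField_mul_volDensity hk hm hy, sigmaMetric_eq_conformalMetric hm,
    laplaceBeltrami_conformalMetric_mul_volDensity]
  have hexponent : ((k + 1 : ℕ) : ℝ) - 2 = k - 1 := by
    push_cast
    ring
  rw [hexponent]
  rfl

theorem conormalCovector_eq_smul (d : ℕ) (y : E d) (i : Fin d) :
    conormalCovector d y i = (-‖y‖⁻¹ • y) i := by
  simp [conormalCovector, div_eq_inv_mul]

theorem conormalLength_eq_exp (hm : 0 < m) (hy : y ≠ 0) :
    conormalLength (k + 1) m ρ y = Real.exp (-conformalExponent k m ‖y‖) := by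
  simp only [conormalLength, sigmaMetric_eq_conformalMetric hm, conformalMetric_inv,
    conormalCovector_eq_smul, sum_smul_one_apply_mul_mul, real_inner_self_eq_norm_sq]
  rw [norm_smul, norm_neg, norm_inv, norm_norm, inv_mul_cancel₀ (norm_ne_zero_iff.2 hy), one_pow,
    mul_one, ← mul_neg, two_mul, Real.exp_add, Real.sqrt_mul_self (Real.exp_nonneg _)]

theorem conormalDeriv_mul (hm : 0 < m) (R : ℝ) (w : E (k + 1) → ℝ) (hy : y ≠ 0) :
    conormalDeriv (k + 1) m ρ R w y *
        (volDensity (sigmaMetric (k + 1) m ρ) y * conormalLength (k + 1) m ρ y) =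
      -(dirichletWeight k m ‖y‖ * (⟪y, gradientWithin w (annulus (k + 1) m R) y⟫_ℝ / ‖y‖)) := by
  have hlength : conormalLength (k + 1) m ρ y ≠ 0 := by
    rw [conormalLength_eq_exp hm hy]
    exact Real.exp_ne_zero _
  have hsum : ∑ i, ∑ j, (sigmaMetric (k + 1) m ρ y)⁻¹ i j * conormalCovector (k + 1) y j *
      pderivOn (annulus (k + 1) m R) i w y = -(Real.exp (-(2 * conformalExponent k m ‖y‖)) *
        (⟪y, gradientWithin w (annulus (k + 1) m R) y⟫_ℝ / ‖y‖)) := by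
    simp only [sigmaMetric_eq_conformalMetric hm, conformalMetric_inv, conormalCovector_eq_smul,
      ← gradientWithin_apply, mul_right_comm _ ((-‖y‖⁻¹ • y) _), sum_smul_one_apply_mul_mul,
      real_inner_smul_right, real_inner_comm y]
    ring
  have hweight : volDensity (sigmaMetric (k + 1) m ρ) y *
      Real.exp (-(2 * conformalExponent k m ‖y‖)) = dirichletWeight k m ‖y‖ := by
    rw [sigmaMetric_eq_conformalMetric hm, volDensity_conformalMetric, ← Real.exp_add,
      dirichletWeight]
    push_cast
    ring_nf
  rw [conormalDeriv, hsum, ← hweight]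
  field_simp

theorem boundaryIntegral_eq_sphereIntegral (d : ℕ) (m : ℝ) (ρ : E (d + 1) ≃ₗᵢ[ℝ] E (d + 1))
    (F : E d → ℝ) :
    boundaryIntegral d m ρ F = sphereIntegral volume (fun y => F y *
      (volDensity (sigmaMetric d m ρ) y * conormalLength d m ρ y)) (horizonRadius (d + 1) m) := by
  rw [boundaryIntegral, sphereIntegral, finrank_euclideanSpace, Fintype.card_fin,
    integral_mul_const, mul_comm]

theorem indexForm_eq (hk : k ≠ 0) (hm : 0 < m) (R : ℝ) (u : SigmaR (k + 1) m ρ R → ℝ) :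
    indexForm (k + 1) m ρ R u =
      -(∫ y in annulus (k + 1) m R, inChart u y * (divergenceOn (annulus (k + 1) m R)
          (fun z => dirichletWeight k m ‖z‖ • gradientWithin (inChart u) (annulus (k + 1) m R) z)
            y + dirichletWeight k m ‖y‖ * jacobiPotential k m ‖y‖ * inChart u y)) -
      sphereIntegral volume (fun y => inChart u y * (dirichletWeight k m ‖y‖ *
        (⟪y, gradientWithin (inChart u) (annulus (k + 1) m R) y⟫_ℝ / ‖y‖)))
        (horizonRadius (k + 2) m) := by
  have hpos : 0 < horizonRadius (k + 2) m := horizonRadius_pos _ hm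
  have hmeas : MeasurableSet (annulus (k + 1) m R) := isClosed_shell.measurableSet
  have hbulk : ∀ y ∈ annulus (k + 1) m R, inChart u y * jacobiOperator (k + 1) m ρ R (inChart u) y *
      volDensity (sigmaMetric (k + 1) m ρ) y = inChart u y * (divergenceOn (annulus (k + 1) m R)
        (fun z => dirichletWeight k m ‖z‖ • gradientWithin (inChart u) (annulus (k + 1) m R) z) y +
        dirichletWeight k m ‖y‖ * jacobiPotential k m ‖y‖ * inChart u y) := fun y hy => by
    rw [mul_assoc, jacobiOperator_mul_volDensity hk hm R _ (ne_zero_of_mem_shell hpos hy)]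
  have hboundary : ∀ y : E (k + 1), ‖y‖ = horizonRadius (k + 2) m →
      inChart u y * (conormalDeriv (k + 1) m ρ R (inChart u) y -
        secondFundamentalForm (schwarzschildMetric (k + 2) m) (horizonNormal (k + 2) m)
          (chart (k + 1) ρ y) (normalField (k + 1) m ρ (chart (k + 1) ρ y))
          (normalField (k + 1) m ρ (chart (k + 1) ρ y)) * inChart u y) *
        (volDensity (sigmaMetric (k + 1) m ρ) y * conormalLength (k + 1) m ρ y) =
      -1 * (inChart u y * (dirichletWeight k m ‖y‖ *
        (⟪y, gradientWithin (inChart u) (annulus (k + 1) m R) y⟫_ℝ / ‖y‖))) := fun y hy => by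
    rw [secondFundamentalForm_horizonNormal hk hm (by rw [norm_chart, hy])
      (inner_chart_normalField _ _ _ _ _), zero_mul, sub_zero, mul_assoc,
      conormalDeriv_mul hm R _ (norm_pos_iff.1 (hy ▸ hpos))]
    ring
  rw [indexForm, boundaryIntegral_eq_sphereIntegral, sphereIntegral_congr hpos.le hboundary,
    setIntegral_congr_fun hmeas hbulk]
  simp only [sphereIntegral, integral_const_mul]
  ring

theorem indexForm_nonneg (hk : 2 ≤ k) (hm : 0 < m) {R : ℝ} (hR : horizonRadius (k + 2) m < R)
    {u : SigmaR (k + 1) m ρ R → ℝ} (hu : Admissible (k + 1) m ρ R u) :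
    0 ≤ indexForm (k + 1) m ρ R u := by
  have hk0 : k ≠ 0 := by omega
  have hpos : 0 < horizonRadius (k + 2) m := horizonRadius_pos _ hm
  have hweight : ContDiffOn ℝ 1 (fun y : E (k + 1) => dirichletWeight k m ‖y‖)
      (annulus (k + 1) m R) :=
    contDiffOn_comp_norm_shell hpos fun _ => contDiffAt_dirichletWeight hm
  have hpotential : ContDiffOn ℝ 1 (fun y : E (k + 1) => jacobiPotential k m ‖y‖)
      (annulus (k + 1) m R) :=
    contDiffOn_comp_norm_shell hpos fun _ => contDiffAt_jacobiPotential hm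
  have hbarrier : ContDiffOn ℝ 1 (fun y : E (k + 1) => barrierSlope k m ‖y‖ • y)
      (annulus (k + 1) m R) :=
    (contDiffOn_comp_norm_shell hpos fun _ => contDiffAt_barrierSlope hm).smul contDiffOn_id
  rw [indexForm_eq hk0 hm]
  refine nonneg_of_barrier_shell hpos hR hweight (fun y _ => Real.exp_nonneg _)
    (hweight.mul hpotential).continuousOn hbarrier (fun y hy => ?_) (fun y hy => ?_)
    (contDiffOn_infty.1 hu.1 2) fun y => inChart_eq_zero_of_norm_eq hu.2
  · -- `k - 1 = 1 + (n - 4)`, so the divergence exceeds `P (|κ y|² + V)` by `(n - 4) P |κ y|²`.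
    rw [divergenceOn_barrier hk0 hm hpos hR hy, ← mul_add, add_comm (_ ^ 2)]
    have hk_sub : (1 : ℝ) ≤ k - 1 := by
      have : (2 : ℝ) ≤ k := by exact_mod_cast hk
      linarith
    have hweight_nonneg : 0 ≤ dirichletWeight k m ‖y‖ := Real.exp_nonneg _
    gcongr
    exact le_mul_of_one_le_left (sq_nonneg _) hk_sub
  · rw [real_inner_smul_right, barrierSlope, hy, inv_add_conformalSlope_horizonRadius hk0 hm,
      zero_div, zero_mul]

theorem morseIndexR_eq_zero (hk : 2 ≤ k) (hm : 0 < m) {R : ℝ}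
    (hR : horizonRadius (k + 2) m < R) : morseIndexR (k + 1) m ρ R = 0 := by
  refine iSup₂_eq_bot.2 ?_
  rintro V ⟨hadm, hneg⟩
  obtain rfl : V = ⊥ := (Submodule.eq_bot_iff V).2 fun u hu => by
    by_contra hne
    exact (hneg u hu hne).not_ge (indexForm_nonneg hk hm hR (hadm u hu))
  simp

end Hypersurface

end Schwarzschild

end

theorem mainTheorem1 (d : ℕ) (hd : 4 ≤ d + 1) (m : ℝ) (hm : 0 < m)
    (ρ : Schwarzschild.E (d + 1) ≃ₗᵢ[ℝ] Schwarzschild.E (d + 1)) :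
    Schwarzschild.morseIndex d m ρ = 0 := by
  obtain ⟨k, rfl⟩ : ∃ k, d = k + 1 := ⟨d - 1, by omega⟩
  have hstable : Schwarzschild.morseIndexR (k + 1) m ρ =ᶠ[atTop] fun _ => 0 :=
    (eventually_gt_atTop _).mono fun R hR => Schwarzschild.morseIndexR_eq_zero (by omega) hm hR
  rw [Schwarzschild.morseIndex, limsup_congr hstable, limsup_const]
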